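/- Let $R$ be an associative ring with unit. Let $\mathcal F_1$ (resp. $\mathcal P_1$) be the class of right $R$-modules of flat (resp. projective) dimension at most $1$, and let $\mathcal F_1^{fp}$ be the class of finitely presented modules in $\mathcal F_1$. For a class $\mathcal C$ of right $R$-modules, let $\mathcal C^{\top}$ be the class of left $R$-modules $M$ with $\operatorname{Tor}_1^R(H,M)=0$ for all $H\in\mathcal C$, and let $\widehat{\mathcal C}$ be the class of right $R$-modules $H$ with $\operatorname{Tor}_1^R(H,M)=0$ for all $M\in\mathcal C^{\top}$. Let $\varinjlim\mathcal C$ be the class of direct limits of direct systems (over nonempty directed sets) of modules in $\mathcal C$. A left module is called $\mathcal C$-flat if it lies in $\mathcal C^{\top}$. The ring $R$ is called right $\mathcal F_1^{fp}$-coherent if every finitely generated flat submodule of a free right $R$-module is finitely presented, and right coherent if every finitely generated right ideal of $R$ is finitely presented. (a) If $R$ is right $\mathcal F_1^{fp}$-coherent, then the following assertions are equivalent: 1. the $\mathcal F_1^{fp}$-flat left $R$-modules are exactly the $\mathcal F_1$-flat ones, that is, $(\mathcal F_1^{fp})^{\top}=\mathcal F_1^{\top}$; 2. the $\mathcal P_1$-flat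 left $R$-modules are exactly the $\mathcal F_1$-flat ones, that is, $\mathcal P_1^{\top}=\mathcal F_1^{\top}$; 3. $\widehat{\mathcal P_1}=\mathcal F_1$; 4. $\varinjlim\mathcal F_1^{fp}=\mathcal F_1$; 5. $\varinjlim\mathcal P_1=\mathcal F_1$. (b) In particular, if $R$ is right coherent, then assertions 1–5 are equivalent. (c) For every field $k$, the commutative ring $R=k[x,y,z]/(z^2,zx,zy)$ is right coherent and satisfies $\varinjlim\mathcal F_1^{fp}\neq\mathcal F_1$. So this equality does not hold in general. -/

import Mathlib

open CategoryTheory CategoryTheory.Limits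
open scoped TensorProduct

universe u

namespace RelFlat

/-! Conventions: `R` is an associative ring with unit, left `R`-modules are `R`-modules and right
`R`-modules are modules over the opposite ring `Rᵐᵒᵖ`, where `h · r` is `MulOpposite.op r • h`.
A class of modules is an `ObjectProperty` of the category of modules. -/

section BalancedTensor

variable (R : Type u) [Ring R]

/-- The relations `(h · r) ⊗ m = h ⊗ (r • m)` in `H ⊗[ℤ] M`. -/
def balancedRelations (H M : Type u) [AddCommGroup H] [Module Rᵐᵒᵖ H]
    [AddCommGroup M] [Module R M] : Submodule ℤ (H ⊗[ℤ] M) :=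
  Submodule.span ℤ {t | ∃ (h : H) (r : R) (m : M),
    t = (MulOpposite.op r • h) ⊗ₜ[ℤ] m - h ⊗ₜ[ℤ] (r • m)}

/-- The tensor product `H ⊗_R M` of a right module `H` and a left module `M` over an arbitrary
ring: an abelian group, here regarded as a `ℤ`-module. -/
abbrev BalancedTensor (H M : Type u) [AddCommGroup H] [Module Rᵐᵒᵖ H]
    [AddCommGroup M] [Module R M] : Type u :=
  (H ⊗[ℤ] M) ⧸ balancedRelations R H M

variable {R}

lemma balancedRelations_le_comap {H M N : Type u} [AddCommGroup H] [Module Rᵐᵒᵖ H]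
    [AddCommGroup M] [Module R M] [AddCommGroup N] [Module R N] (f : M →ₗ[R] N) :
    balancedRelations R H M ≤ (balancedRelations R H N).comap
      (LinearMap.lTensor H f.toAddMonoidHom.toIntLinearMap) := by
  refine Submodule.span_le.2 ?_
  rintro _ ⟨h, r, m, rfl⟩
  refine Submodule.subset_span ⟨h, r, f m, ?_⟩
  simp

/-- The map `id ⊗ f : H ⊗_R M → H ⊗_R N` induced by `f : M → N`. -/
def balancedMap (H : Type u) {M N : Type u} [AddCommGroup H] [Module Rᵐᵒᵖ H]
    [AddCommGroup M] [Module R M] [AddCommGroup N] [Module R N] (f : M →ₗ[R] N) :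
    BalancedTensor R H M →ₗ[ℤ] BalancedTensor R H N :=
  Submodule.mapQ _ _ (LinearMap.lTensor H f.toAddMonoidHom.toIntLinearMap)
    (balancedRelations_le_comap f)

lemma balancedTensor_hom_ext {H M : Type u} [AddCommGroup H] [Module Rᵐᵒᵖ H]
    [AddCommGroup M] [Module R M] {A : Type u} [AddCommGroup A]
    {f g : BalancedTensor R H M →ₗ[ℤ] A}
    (w : ∀ (h : H) (m : M), f (Submodule.Quotient.mk (h ⊗ₜ[ℤ] m)) =
      g (Submodule.Quotient.mk (h ⊗ₜ[ℤ] m))) : f = g := by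
  refine Submodule.linearMap_qext _ (TensorProduct.ext' fun h m => ?_)
  exact w h m

/-- The functor `H ⊗_R -` from left `R`-modules to abelian groups. -/
def tensorFunctor (H : ModuleCat.{u} Rᵐᵒᵖ) : ModuleCat.{u} R ⥤ ModuleCat.{u} ℤ where
  obj M := ModuleCat.of ℤ (BalancedTensor R H M)
  map f := ModuleCat.ofHom (balancedMap H f.hom)
  map_id M := by
    refine ModuleCat.hom_ext (balancedTensor_hom_ext fun h m => ?_)
    rfl
  map_comp f g := by
    refine ModuleCat.hom_ext (balancedTensor_hom_ext fun h m => ?_)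
    rfl

instance (H : ModuleCat.{u} Rᵐᵒᵖ) : (tensorFunctor H).Additive where
  map_add {M N f g} := by
    refine ModuleCat.hom_ext (balancedTensor_hom_ext fun h m => ?_)
    change Submodule.Quotient.mk (h ⊗ₜ[ℤ] (f.hom m + g.hom m)) = _
    rw [TensorProduct.tmul_add]
    rfl

/-- `Tor_n^R(H, M)`: the value at `M` of the `n`-th left derived functor of `H ⊗_R -`. -/
noncomputable def tor (n : ℕ) (H : ModuleCat.{u} Rᵐᵒᵖ) (M : ModuleCat.{u} R) : ModuleCat.{u} ℤ :=
  ((tensorFunctor H).leftDerived n).obj M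

end BalancedTensor

section Classes

variable (R : Type u) [Ring R]

/-- A right module `H` is flat if `H ⊗_R -` preserves injections. -/
def IsFlatRight : ObjectProperty (ModuleCat.{u} Rᵐᵒᵖ) := fun H =>
  (tensorFunctor H).PreservesMonomorphisms

/-- `flatDimLE R n` is the class of right modules of flat dimension at most `n`, that is, those
with a resolution `0 → F_n → ⋯ → F_0 → H → 0` by flat modules. -/
def flatDimLE : ℕ → ObjectProperty (ModuleCat.{u} Rᵐᵒᵖ)
  | 0 => IsFlatRight R
  | n + 1 => fun H => ∃ (K F : ModuleCat.{u} Rᵐᵒᵖ) (i : K ⟶ F) (p : F ⟶ H) (w : i ≫ p = 0),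
      (ShortComplex.mk i p w).ShortExact ∧ IsFlatRight R F ∧ flatDimLE n K

/-- The class `F₁` of right modules of flat dimension at most one. -/
def F1 : ObjectProperty (ModuleCat.{u} Rᵐᵒᵖ) := flatDimLE R 1

/-- The class `P₁` of right modules of projective dimension at most one. -/
def P1 : ObjectProperty (ModuleCat.{u} Rᵐᵒᵖ) := fun H => HasProjectiveDimensionLE H 1

/-- The class `F₁^fp` of finitely presented right modules of flat dimension at most one. -/
def F1fp : ObjectProperty (ModuleCat.{u} Rᵐᵒᵖ) := fun H =>
  F1 R H ∧ Module.FinitePresentation Rᵐᵒᵖ H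

variable {R}

/-- `C^⊤`: the left modules `M` with `Tor_1^R(H, M) = 0` for all `H` in the class `C`. -/
def torRightOrthogonal (C : ObjectProperty (ModuleCat.{u} Rᵐᵒᵖ)) :
    ObjectProperty (ModuleCat.{u} R) := fun M => ∀ H, C H → IsZero (tor 1 H M)

/-- `^⊤D`: the right modules `H` with `Tor_1^R(H, M) = 0` for all `M` in the class `D`. -/
def torLeftOrthogonal (D : ObjectProperty (ModuleCat.{u} R)) :
    ObjectProperty (ModuleCat.{u} Rᵐᵒᵖ) := fun H => ∀ M, D M → IsZero (tor 1 H M)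

/-- The closure `^⊤(C^⊤)` of a class `C` of right modules. -/
def hat (C : ObjectProperty (ModuleCat.{u} Rᵐᵒᵖ)) : ObjectProperty (ModuleCat.{u} Rᵐᵒᵖ) :=
  torLeftOrthogonal (torRightOrthogonal C)

/-- The class of all direct limits of direct systems, indexed by nonempty directed sets, of
modules from the class `C`. -/
def dirLim (C : ObjectProperty (ModuleCat.{u} Rᵐᵒᵖ)) : ObjectProperty (ModuleCat.{u} Rᵐᵒᵖ) :=
  fun X => ∃ (ι : Type u) (_ : PartialOrder ι) (_ : IsDirectedOrder ι) (_ : Nonempty ι)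
    (pres : ColimitPresentation ι X), ∀ i, C (pres.diag.obj i)

variable (R)

/-- The class of `F₁`-flat left modules. -/
def F1Flat : ObjectProperty (ModuleCat.{u} R) := torRightOrthogonal (F1 R)

/-- The class of `F₁^fp`-flat left modules. -/
def F1fpFlat : ObjectProperty (ModuleCat.{u} R) := torRightOrthogonal (F1fp R)

/-- The class of `P₁`-flat left modules. -/
def P1Flat : ObjectProperty (ModuleCat.{u} R) := torRightOrthogonal (P1 R)

/-- `R` is right `F₁^fp`-coherent if every finitely generated flat submodule of a free right
module is finitely presented. -/
def IsRightF1fpCoherent : Prop :=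
  ∀ (L : Type u) [AddCommGroup L] [Module Rᵐᵒᵖ L] [Module.Free Rᵐᵒᵖ L] (N : Submodule Rᵐᵒᵖ L),
    N.FG → IsFlatRight R (ModuleCat.of Rᵐᵒᵖ N) → Module.FinitePresentation Rᵐᵒᵖ N

/-- `R` is right coherent if every finitely generated right ideal is finitely presented. -/
def IsRightCoherent : Prop :=
  ∀ I : Submodule Rᵐᵒᵖ R, I.FG → Module.FinitePresentation Rᵐᵒᵖ I

end Classes

/-- The ideal `(z², zx, zy)` of `k[x, y, z]`, the variables `x, y, z` being `X 0, X 1, X 2`. -/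
noncomputable def bazzoniHerberaIdeal (k : Type u) [Field k] : Ideal (MvPolynomial (Fin 3) k) :=
  Ideal.span {MvPolynomial.X 2 ^ 2, MvPolynomial.X 2 * MvPolynomial.X 0,
    MvPolynomial.X 2 * MvPolynomial.X 1}

/-- The ring `k[x, y, z] / (z², zx, zy)`. -/
abbrev BazzoniHerberaRing (k : Type u) [Field k] : Type u :=
  MvPolynomial (Fin 3) k ⧸ bazzoniHerberaIdeal k

end RelFlat

/-! Everything is compared with one class of left modules. Call a matrix over `R` injective if it
acts injectively on columns over `R`, and let `MatrixFlat R` consist of the left modules on whose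
columns every injective matrix acts injectively. An injective matrix is an injection between finite
free right modules. Its cokernel lies in both `P1 R` and `F1fp R`, and Tor-orthogonality to all
these cokernels means exactly matrix-flatness.

Conversely, matrix-flat modules are Tor-orthogonal to all of `P1 R`: a free syzygy reduces to finite
matrices, and a projective syzygy reduces to a free one. Hence `P1Flat R = MatrixFlat R`
(`P1Flat_eq`). Under the coherence hypothesis `F1fp R ≤ P1 R`, so `F1fpFlat R` is the same class
(`F1fpFlat_eq`).

Both direct limit closures equal `torLeftOrthogonal (MatrixFlat R)`. One inclusion holds because Tor
commutes with direct limits. For the other, `exists_factorization_matrixCokernel` factors each map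
from a finitely presented module to a module of this class through the cokernel of an injective
matrix, which makes the target a direct limit of such cokernels. The test module there is a quotient
of `Rⁿ` made matrix-flat by `matrixTorsion`.

Finally `hat (F1 R) = F1 R`, because submodules of projective left modules are `F1`-flat and detect
flatness of first syzygies. By the Galois connection given by Tor-orthogonality, each of the five
assertions becomes `MatrixFlat R = F1Flat R`.

In the counterexample, `z` spans a copy of `k` killed by the variables, so an injective matrix stays
injective modulo `(x, y, z)`. This makes `k[y]` matrix-flat. But `R_y / x R_y` has flat dimension at
most one, and its `Tor_1` with `k[y]` is nonzero because `x` kills `k[y]`. -/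

namespace RelFlat

open MulOpposite

/-! ### Tensor products over a noncommutative ring -/

section Tensor

variable (R : Type u) [Ring R]

/-- The pure tensor `h ⊗ m` in `H ⊗_R M`. -/
def btmul {H M : Type u} [AddCommGroup H] [Module Rᵐᵒᵖ H] [AddCommGroup M] [Module R M]
    (h : H) (m : M) : BalancedTensor R H M :=
  Submodule.Quotient.mk (h ⊗ₜ[ℤ] m)

variable {R}
variable {H K F M N P : Type u} [AddCommGroup H] [Module Rᵐᵒᵖ H] [AddCommGroup K] [Module Rᵐᵒᵖ K]
  [AddCommGroup F] [Module Rᵐᵒᵖ F] [AddCommGroup M] [Module R M] [AddCommGroup N] [Module R N]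
  [AddCommGroup P] [Module R P] {A : Type u} [AddCommGroup A]

lemma btmul_add (h : H) (m m' : M) : btmul R h (m + m') = btmul R h m + btmul R h m' := by
  simp [btmul, TensorProduct.tmul_add]

lemma add_btmul (h h' : H) (m : M) : btmul R (h + h') m = btmul R h m + btmul R h' m := by
  simp [btmul, TensorProduct.add_tmul]

lemma btmul_smul (h : H) (r : R) (m : M) : btmul R h (r • m) = btmul R (op r • h) m := by
  refine Eq.symm ((Submodule.Quotient.eq _).2 ?_)
  exact Submodule.subset_span ⟨h, r, m, rfl⟩

lemma smul_btmul (h : H) (r : Rᵐᵒᵖ) (m : M) : btmul R (r • h) m = btmul R h (unop r • m) := by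
  rw [btmul_smul, op_unop]

/-- `btmul` as a biadditive map. -/
def btmulHom (R : Type u) [Ring R] (H M : Type u) [AddCommGroup H] [Module Rᵐᵒᵖ H]
    [AddCommGroup M] [Module R M] : H →+ M →+ BalancedTensor R H M :=
  AddMonoidHom.mk' (fun h => AddMonoidHom.mk' (btmul R h) (btmul_add h))
    fun h h' => AddMonoidHom.ext fun m => add_btmul h h' m

lemma btmul_zero (h : H) : btmul R h (0 : M) = 0 := (btmulHom R H M h).map_zero

lemma zero_btmul (m : M) : btmul R (0 : H) m = 0 :=
  DFunLike.congr_fun (btmulHom R H M).map_zero m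

lemma btmul_sum {ι : Type*} (s : Finset ι) (h : H) (m : ι → M) :
    btmul R h (∑ i ∈ s, m i) = ∑ i ∈ s, btmul R h (m i) :=
  map_sum (btmulHom R H M h) m s

lemma sum_btmul {ι : Type*} (s : Finset ι) (h : ι → H) (m : M) :
    btmul R (∑ i ∈ s, h i) m = ∑ i ∈ s, btmul R (h i) m :=
  map_sum ((btmulHom R H M).flip m) h s

@[elab_as_elim]
lemma balancedTensor_induction {p : BalancedTensor R H M → Prop} (t : BalancedTensor R H M)
    (zero : p 0) (tmul : ∀ h m, p (btmul R h m)) (add : ∀ x y, p x → p y → p (x + y)) : p t := by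
  obtain ⟨t, rfl⟩ := Submodule.Quotient.mk_surjective _ t
  induction t with
  | zero => exact zero
  | tmul h m => exact tmul h m
  | add x y hx hy => exact add _ _ hx hy

/-- Biadditive balanced maps factor through `H ⊗_R M`. -/
def btlift (φ : H →+ M →+ A) (hφ : ∀ h (r : R) m, φ (op r • h) m = φ h (r • m)) :
    BalancedTensor R H M →ₗ[ℤ] A :=
  (balancedRelations R H M).liftQ
    (TensorProduct.liftAddHom φ fun n h m => by simp).toIntLinearMap <| by
    refine Submodule.span_le.2 ?_
    rintro _ ⟨h, r, m, rfl⟩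
    simp [hφ]

@[simp]
lemma balancedMap_btmul (f : M →ₗ[R] N) (h : H) (m : M) :
    balancedMap H f (btmul R h m) = btmul R h (f m) := rfl

lemma balancedRelations_le_comap_rTensor (f : H →ₗ[Rᵐᵒᵖ] K) (M : Type u) [AddCommGroup M]
    [Module R M] : balancedRelations R H M ≤ (balancedRelations R K M).comap
      (LinearMap.rTensor M f.toAddMonoidHom.toIntLinearMap) := by
  refine Submodule.span_le.2 ?_
  rintro _ ⟨h, r, m, rfl⟩
  refine Submodule.subset_span ⟨f h, r, m, ?_⟩
  simp

/-- The map `f ⊗ id : H ⊗_R M → K ⊗_R M` induced by `f : H → K`. -/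
def balancedMapLeft (M : Type u) [AddCommGroup M] [Module R M] (f : H →ₗ[Rᵐᵒᵖ] K) :
    BalancedTensor R H M →ₗ[ℤ] BalancedTensor R K M :=
  Submodule.mapQ _ _ (LinearMap.rTensor M f.toAddMonoidHom.toIntLinearMap)
    (balancedRelations_le_comap_rTensor f M)

@[simp]
lemma balancedMapLeft_btmul (f : H →ₗ[Rᵐᵒᵖ] K) (h : H) (m : M) :
    balancedMapLeft M f (btmul R h m) = btmul R (f h) m := rfl

lemma balancedMap_comp_apply (g : N →ₗ[R] P) (f : M →ₗ[R] N) (t : BalancedTensor R H M) :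
    balancedMap H (g ∘ₗ f) t = balancedMap H g (balancedMap H f t) := by
  induction t using balancedTensor_induction with
  | zero => simp
  | tmul h m => simp
  | add x y hx hy => simp [hx, hy]

lemma balancedMapLeft_comp_apply (g : K →ₗ[Rᵐᵒᵖ] F) (f : H →ₗ[Rᵐᵒᵖ] K)
    (t : BalancedTensor R H M) :
    balancedMapLeft M (g ∘ₗ f) t = balancedMapLeft M g (balancedMapLeft M f t) := by
  induction t using balancedTensor_induction with
  | zero => simp
  | tmul h m => simp
  | add x y hx hy => simp [hx, hy]

lemma balancedMap_id_apply (t : BalancedTensor R H M) : balancedMap H LinearMap.id t = t := by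
  induction t using balancedTensor_induction with
  | zero => simp
  | tmul h m => simp
  | add x y hx hy => simp [hx, hy]

lemma balancedMapLeft_id_apply (t : BalancedTensor R H M) :
    balancedMapLeft M (LinearMap.id : H →ₗ[Rᵐᵒᵖ] H) t = t := by
  induction t using balancedTensor_induction with
  | zero => simp
  | tmul h m => simp
  | add x y hx hy => simp [hx, hy]

lemma balancedMap_comm (f : H →ₗ[Rᵐᵒᵖ] K) (g : M →ₗ[R] N) (t : BalancedTensor R H M) :
    balancedMap K g (balancedMapLeft M f t) = balancedMapLeft N f (balancedMap H g t) := by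
  induction t using balancedTensor_induction with
  | zero => simp
  | tmul h m => simp
  | add x y hx hy => simp [hx, hy]

lemma balancedMap_surjective (H : Type u) [AddCommGroup H] [Module Rᵐᵒᵖ H] {g : M →ₗ[R] N}
    (hg : Function.Surjective g) : Function.Surjective (balancedMap H g) := by
  intro t
  induction t using balancedTensor_induction with
  | zero => exact ⟨0, map_zero _⟩
  | tmul h n =>
    obtain ⟨m, rfl⟩ := hg n
    exact ⟨btmul R h m, rfl⟩
  | add x y hx hy =>
    obtain ⟨⟨a, rfl⟩, b, rfl⟩ := hx, hy
    exact ⟨a + b, map_add _ _ _⟩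

lemma balancedMapLeft_surjective (M : Type u) [AddCommGroup M] [Module R M] {g : H →ₗ[Rᵐᵒᵖ] K}
    (hg : Function.Surjective g) : Function.Surjective (balancedMapLeft M g) := by
  intro t
  induction t using balancedTensor_induction with
  | zero => exact ⟨0, map_zero _⟩
  | tmul h n =>
    obtain ⟨m, rfl⟩ := hg h
    exact ⟨btmul R m n, rfl⟩
  | add x y hx hy =>
    obtain ⟨⟨a, rfl⟩, b, rfl⟩ := hx, hy
    exact ⟨a + b, map_add _ _ _⟩

/-- Right exactness is inherited from the tensor product over `ℤ`. Since `g` is surjective, the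
balancing relations over `P` lift to relations over `N`, and subtracting such a lift moves a
representative into the kernel over `ℤ`. -/
lemma balancedMap_exact (H : Type u) [AddCommGroup H] [Module Rᵐᵒᵖ H] {f : M →ₗ[R] N}
    {g : N →ₗ[R] P} (hfg : Function.Exact f g) (hg : Function.Surjective g) :
    Function.Exact (balancedMap H f) (balancedMap H g) := by
  rw [Function.Exact]
  refine fun t => ⟨fun ht => ?_, ?_⟩
  · have hr : balancedRelations R H P ≤ (balancedRelations R H N).map
        (LinearMap.lTensor H g.toAddMonoidHom.toIntLinearMap) := by
      refine Submodule.span_le.2 ?_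
      rintro _ ⟨h, r, p, rfl⟩
      obtain ⟨n, rfl⟩ := hg p
      exact ⟨_, Submodule.subset_span ⟨h, r, n, rfl⟩, by simp⟩
    obtain ⟨t, rfl⟩ := Submodule.Quotient.mk_surjective _ t
    obtain ⟨r, hr, hrt⟩ := hr ((Submodule.Quotient.mk_eq_zero _).1 ht)
    obtain ⟨l, hl⟩ := (lTensor_exact H (f := f.toAddMonoidHom.toIntLinearMap)
      (g := g.toAddMonoidHom.toIntLinearMap) hfg hg (t - r)).1 ((map_sub _ _ _).trans (sub_eq_zero.2 hrt.symm))
    refine ⟨Submodule.Quotient.mk l, ?_⟩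
    refine (Submodule.Quotient.eq _).2 ?_
    exact (congrArg (· - t) hl).trans (sub_sub_cancel_left t r) ▸ neg_mem hr
  · rintro ⟨s, rfl⟩
    rw [← balancedMap_comp_apply]
    induction s using balancedTensor_induction with
    | zero => simp
    | tmul h m => simp [hfg.apply_apply_eq_zero, btmul_zero]
    | add x y hx hy => simp [hx, hy]

lemma balancedMapLeft_exact (M : Type u) [AddCommGroup M] [Module R M] {f : K →ₗ[Rᵐᵒᵖ] F}
    {g : F →ₗ[Rᵐᵒᵖ] H} (hfg : Function.Exact f g) (hg : Function.Surjective g) :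
    Function.Exact (balancedMapLeft M f) (balancedMapLeft M g) := by
  rw [Function.Exact]
  refine fun t => ⟨fun ht => ?_, ?_⟩
  · have hr : balancedRelations R H M ≤ (balancedRelations R F M).map
        (LinearMap.rTensor M g.toAddMonoidHom.toIntLinearMap) := by
      refine Submodule.span_le.2 ?_
      rintro _ ⟨h, r, p, rfl⟩
      obtain ⟨n, rfl⟩ := hg h
      exact ⟨_, Submodule.subset_span ⟨n, r, p, rfl⟩, by simp⟩
    obtain ⟨t, rfl⟩ := Submodule.Quotient.mk_surjective _ t
    obtain ⟨r, hr, hrt⟩ := hr ((Submodule.Quotient.mk_eq_zero _).1 ht)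
    obtain ⟨l, hl⟩ := (rTensor_exact M (f := f.toAddMonoidHom.toIntLinearMap)
      (g := g.toAddMonoidHom.toIntLinearMap) hfg hg (t - r)).1 ((map_sub _ _ _).trans (sub_eq_zero.2 hrt.symm))
    refine ⟨Submodule.Quotient.mk l, ?_⟩
    refine (Submodule.Quotient.eq _).2 ?_
    exact (congrArg (· - t) hl).trans (sub_sub_cancel_left t r) ▸ neg_mem hr
  · rintro ⟨s, rfl⟩
    rw [← balancedMapLeft_comp_apply]
    induction s using balancedTensor_induction with
    | zero => simp
    | tmul h m => simp [hfg.apply_apply_eq_zero, zero_btmul]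
    | add x y hx hy => simp [hx, hy]

/-- The pairing `H ⊗_R (ι → R) → H` given by the `j`-th coordinate of the second factor. -/
def coordRight (H : Type u) [AddCommGroup H] [Module Rᵐᵒᵖ H] {V : Type u} [AddCommGroup V]
    [Module R V] (c : V →ₗ[R] R) : BalancedTensor R H V →ₗ[ℤ] H :=
  btlift (AddMonoidHom.mk' (fun h => AddMonoidHom.mk' (fun v => op (c v) • h)
      fun v w => by simp [add_smul]) fun h h' => by ext; simp)
    fun h r v => by simp [mul_smul]

@[simp]
lemma coordRight_btmul {V : Type u} [AddCommGroup V] [Module R V] (c : V →ₗ[R] R) (h : H) (v : V) :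
    coordRight H c (btmul R h v) = op (c v) • h := rfl

/-- The pairing `V ⊗_R M → M` given by a linear form on the right module `V`. -/
def coordLeft (M : Type u) [AddCommGroup M] [Module R M] {V : Type u} [AddCommGroup V]
    [Module Rᵐᵒᵖ V] (c : V →ₗ[Rᵐᵒᵖ] Rᵐᵒᵖ) : BalancedTensor R V M →ₗ[ℤ] M :=
  btlift (AddMonoidHom.mk' (fun v => AddMonoidHom.mk' (fun m => unop (c v) • m)
      fun v w => by simp) fun h h' => by ext; simp [add_smul])
    fun h r v => by simp [mul_smul]

@[simp]
lemma coordLeft_btmul {V : Type u} [AddCommGroup V] [Module Rᵐᵒᵖ V] (c : V →ₗ[Rᵐᵒᵖ] Rᵐᵒᵖ) (v : V)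
    (m : M) : coordLeft M c (btmul R v m) = unop (c v) • m := rfl

section Basis

variable {I : Type*} {V : Type u} [AddCommGroup V]

/-- Every tensor with a free right module is a finite sum of `e_i ⊗ m_i`. -/
lemma exists_finsupp_left [Module Rᵐᵒᵖ V] (b : Module.Basis I Rᵐᵒᵖ V) (t : BalancedTensor R V M) :
    ∃ n : I →₀ M, t = n.sum fun i m => btmul R (b i) m := by
  classical
  induction t using balancedTensor_induction with
  | zero => exact ⟨0, by simp⟩
  | tmul h m =>
    refine ⟨(b.repr h).mapRange (fun a => unop a • m) (by simp), ?_⟩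
    rw [Finsupp.sum_mapRange_index (by simp [btmul_zero])]
    conv_lhs => rw [← b.linearCombination_repr h, Finsupp.linearCombination_apply, Finsupp.sum,
      sum_btmul]
    exact Finset.sum_congr rfl fun i _ => smul_btmul _ _ _
  | add x y hx hy =>
    obtain ⟨⟨a, rfl⟩, b, rfl⟩ := hx, hy
    refine ⟨a + b, ?_⟩
    rw [Finsupp.sum_add_index']
    · simp [btmul_zero]
    · intro i m m'
      rw [btmul_add]

/-- Every tensor with a free left module is a finite sum of `h_i ⊗ e_i`. -/
lemma exists_finsupp_right [Module R V] (b : Module.Basis I R V) (t : BalancedTensor R H V) :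
    ∃ n : I →₀ H, t = n.sum fun i h => btmul R h (b i) := by
  classical
  induction t using balancedTensor_induction with
  | zero => exact ⟨0, by simp⟩
  | tmul h m =>
    refine ⟨(b.repr m).mapRange (fun a => op a • h) (by simp), ?_⟩
    rw [Finsupp.sum_mapRange_index (by simp [zero_btmul])]
    conv_lhs => rw [← b.linearCombination_repr m, Finsupp.linearCombination_apply, Finsupp.sum,
      btmul_sum]
    exact Finset.sum_congr rfl fun i _ => btmul_smul _ _ _
  | add x y hx hy =>
    obtain ⟨⟨a, rfl⟩, b, rfl⟩ := hx, hy
    refine ⟨a + b, ?_⟩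
    rw [Finsupp.sum_add_index']
    · simp [zero_btmul]
    · intro i m m'
      rw [add_btmul]

lemma coordLeft_finsupp_sum [Module Rᵐᵒᵖ V] (b : Module.Basis I Rᵐᵒᵖ V) (n : I →₀ M) (j : I) :
    coordLeft M (b.coord j) (n.sum fun i m => btmul R (b i) m) = n j := by
  classical
  rw [map_finsuppSum, Finsupp.sum_eq_single j]
  · simp
  · intro i _ hij
    simp [hij]
  · simp

lemma coordRight_finsupp_sum [Module R V] (b : Module.Basis I R V) (n : I →₀ H) (j : I) :
    coordRight H (b.coord j) (n.sum fun i h => btmul R h (b i)) = n j := by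
  classical
  rw [map_finsuppSum, Finsupp.sum_eq_single j]
  · simp
  · intro i _ hij
    simp [hij]
  · simp

lemma eq_zero_of_coordLeft [Module Rᵐᵒᵖ V] (b : Module.Basis I Rᵐᵒᵖ V) (t : BalancedTensor R V M)
    (h : ∀ j, coordLeft M (b.coord j) t = 0) : t = 0 := by
  obtain ⟨n, rfl⟩ := exists_finsupp_left b t
  have : n = 0 := by
    ext j
    rw [← coordLeft_finsupp_sum b n j, h j, Finsupp.zero_apply]
  rw [this, Finsupp.sum_zero_index]

lemma eq_zero_of_coordRight [Module R V] (b : Module.Basis I R V) (t : BalancedTensor R H V)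
    (h : ∀ j, coordRight H (b.coord j) t = 0) : t = 0 := by
  obtain ⟨n, rfl⟩ := exists_finsupp_right b t
  have : n = 0 := by
    ext j
    rw [← coordRight_finsupp_sum b n j, h j, Finsupp.zero_apply]
  rw [this, Finsupp.sum_zero_index]

end Basis

lemma coordLeft_map (f : M →ₗ[R] N) {V : Type u} [AddCommGroup V] [Module Rᵐᵒᵖ V]
    (c : V →ₗ[Rᵐᵒᵖ] Rᵐᵒᵖ) (t : BalancedTensor R V M) :
    coordLeft N c (balancedMap V f t) = f (coordLeft M c t) := by
  induction t using balancedTensor_induction with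
  | zero => simp
  | tmul h m => simp
  | add x y hx hy => simp [hx, hy]

lemma coordRight_map (f : H →ₗ[Rᵐᵒᵖ] K) {V : Type u} [AddCommGroup V] [Module R V]
    (c : V →ₗ[R] R) (t : BalancedTensor R H V) :
    coordRight K c (balancedMapLeft V f t) = f (coordRight H c t) := by
  induction t using balancedTensor_induction with
  | zero => simp
  | tmul h m => simp
  | add x y hx hy => simp [hx, hy]

/-- Projective left modules are flat. -/
lemma balancedMapLeft_injective_of_projective [Module.Projective R P] {f : K →ₗ[Rᵐᵒᵖ] F}
    (hf : Function.Injective f) : Function.Injective (balancedMapLeft P f) := by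
  obtain ⟨s, hs⟩ := Module.projective_lifting_property
    (Finsupp.linearCombination R (id : P → P)) LinearMap.id
    (Finsupp.linearCombination_id_surjective R P)
  rw [injective_iff_map_eq_zero]
  intro t ht
  -- The section `s` embeds `P` in a free module, where a tensor is zero as soon as its coordinates
  -- are, and coordinates commute with the injection `f`.
  have h0 : balancedMap K s t = 0 := by
    refine eq_zero_of_coordRight Finsupp.basisSingleOne _ fun j => hf ?_
    rw [← coordRight_map, ← balancedMap_comm, ht]
    simp
  have := balancedMap_comp_apply (H := K) (Finsupp.linearCombination R (id : P → P)) s t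
  rwa [hs, balancedMap_id_apply, h0, map_zero] at this

/-- Projective right modules are flat. -/
lemma balancedMap_injective_of_projective [Module.Projective Rᵐᵒᵖ F] {f : M →ₗ[R] N}
    (hf : Function.Injective f) : Function.Injective (balancedMap F f) := by
  obtain ⟨s, hs⟩ := Module.projective_lifting_property
    (Finsupp.linearCombination Rᵐᵒᵖ (id : F → F)) LinearMap.id
    (Finsupp.linearCombination_id_surjective Rᵐᵒᵖ F)
  rw [injective_iff_map_eq_zero]
  intro t ht
  have h0 : balancedMapLeft M s t = 0 := by
    refine eq_zero_of_coordLeft Finsupp.basisSingleOne _ fun j => hf ?_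
    rw [← coordLeft_map, balancedMap_comm, ht]
    simp
  have := balancedMapLeft_comp_apply (M := M)
    (Finsupp.linearCombination Rᵐᵒᵖ (id : F → F)) s t
  rwa [hs, balancedMapLeft_id_apply, h0, map_zero] at this

end Tensor

/-! ### Vanishing of Tor and modules of flat dimension at most one -/

section Tor

variable {R : Type u} [Ring R]

lemma isZero_tor_one_iff_exact (H : ModuleCat.{u} Rᵐᵒᵖ) {M : ModuleCat.{u} R}
    (Q : ProjectiveResolution M) : IsZero (tor 1 H M) ↔
      Function.Exact (balancedMap H (Q.complex.d 2 1).hom)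
        (balancedMap H (Q.complex.d 1 0).hom) := by
  rw [tor, (Q.isoLeftDerivedObj (tensorFunctor H) 1).isZero_iff]
  refine (HomologicalComplex.exactAt_iff_isZero_homology _ _).symm.trans ?_
  rw [HomologicalComplex.exactAt_iff' _ 2 1 0 (by simp) (by simp)]
  exact ShortComplex.ShortExact.moduleCat_exact_iff_function_exact _

/-- A projective presentation `0 → L → P → M → 0` computing the vanishing of `Tor_1(-, M)`. -/
lemma exists_projective_presentation_tor (M : ModuleCat.{u} R) :
    ∃ (P : ModuleCat.{u} R) (p : P →ₗ[R] M), Module.Projective R P ∧ Function.Surjective p ∧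
      ∀ H : ModuleCat.{u} Rᵐᵒᵖ, IsZero (tor 1 H M) ↔
        Function.Injective (balancedMap H (LinearMap.ker p).subtype) := by
  let Q := projectiveResolution M
  obtain ⟨p, hp, hex⟩ : ∃ p : Q.complex.X 0 →ₗ[R] M, Function.Surjective p ∧
      Function.Exact (Q.complex.d 1 0).hom p :=
    ⟨(Q.π.f 0).hom, (ModuleCat.epi_iff_surjective (Q.π.f 0)).1 inferInstance,
      (ShortComplex.ShortExact.moduleCat_exact_iff_function_exact _).1 Q.exact₀⟩
  have hex2 : Function.Exact (Q.complex.d 2 1).hom (Q.complex.d 1 0).hom :=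
    (ShortComplex.ShortExact.moduleCat_exact_iff_function_exact _).1 (Q.exact_succ 0)
  refine ⟨Q.complex.X 0, p, (IsProjective.iff_projective _).2 (Q.projective 0), hp, fun H => ?_⟩
  rw [isZero_tor_one_iff_exact H Q]
  let q : Q.complex.X 1 →ₗ[R] LinearMap.ker p :=
    (Q.complex.d 1 0).hom.codRestrict _ fun x => hex.apply_apply_eq_zero x
  have hq : Function.Surjective q := by
    rintro ⟨y, hy⟩
    obtain ⟨x, rfl⟩ := (hex y).1 hy
    exact ⟨x, rfl⟩
  have hq2 : Function.Exact (Q.complex.d 2 1).hom q := fun x => by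
    rw [← hex2 x, Subtype.ext_iff]
    rfl
  have hE := balancedMap_exact H hq2 hq
  have hcomp : ∀ t, balancedMap H (Q.complex.d 1 0).hom t =
      balancedMap H (LinearMap.ker p).subtype (balancedMap H q t) := fun t => by
    rw [← balancedMap_comp_apply]
    rfl
  constructor
  · intro h
    rw [injective_iff_map_eq_zero]
    intro t ht
    obtain ⟨s, rfl⟩ := balancedMap_surjective H hq t
    rw [← hcomp, h] at ht
    exact (hE s).2 ht
  · intro h t
    rw [hcomp, ← hE t]
    exact map_eq_zero_iff _ h

lemma flat_injective {F : ModuleCat.{u} Rᵐᵒᵖ} (hF : IsFlatRight R F) {M N : Type u}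
    [AddCommGroup M] [Module R M] [AddCommGroup N] [Module R N] {f : M →ₗ[R] N}
    (hf : Function.Injective f) : Function.Injective (balancedMap F f) := by
  have : Mono (ModuleCat.ofHom f) := (ModuleCat.mono_iff_injective _).2 hf
  have := hF.preserves (ModuleCat.ofHom f)
  exact (ModuleCat.mono_iff_injective _).1 this

lemma isFlatRight_iff (F : ModuleCat.{u} Rᵐᵒᵖ) : IsFlatRight R F ↔
    ∀ (M N : Type u) [AddCommGroup M] [Module R M] [AddCommGroup N] [Module R N] (f : M →ₗ[R] N),
      Function.Injective f → Function.Injective (balancedMap F f) := by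
  refine ⟨fun hF M N _ _ _ _ f => flat_injective hF, fun h => ⟨fun {X Y} f hf => ?_⟩⟩
  exact (ModuleCat.mono_iff_injective _).2 (h X Y f.hom ((ModuleCat.mono_iff_injective _).1 hf))

lemma isFlatRight_of_projective (F : ModuleCat.{u} Rᵐᵒᵖ) [Module.Projective Rᵐᵒᵖ F] :
    IsFlatRight R F :=
  (isFlatRight_iff F).2 fun _ _ _ _ _ _ _ => balancedMap_injective_of_projective

/-- The vanishing of `Tor_1(H, M)` can be computed from a flat presentation of `H`. -/
lemma isZero_tor_one_iff {K F H : ModuleCat.{u} Rᵐᵒᵖ} {i : K →ₗ[Rᵐᵒᵖ] F} {p : F →ₗ[Rᵐᵒᵖ] H}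
    (hF : IsFlatRight R F) (hi : Function.Injective i) (hip : Function.Exact i p)
    (hp : Function.Surjective p) (M : ModuleCat.{u} R) :
    IsZero (tor 1 H M) ↔ Function.Injective (balancedMapLeft M i) := by
  obtain ⟨P, q, _, hq, hT⟩ := exists_projective_presentation_tor M
  rw [hT]
  set j := (LinearMap.ker q).subtype
  have hj : Function.Injective j := Subtype.val_injective
  have hjq : Function.Exact j q := LinearMap.exact_subtype_ker_map q
  have hKP : Function.Injective (balancedMapLeft P i) := balancedMapLeft_injective_of_projective hi
  have hFL : Function.Injective (balancedMap F j) := flat_injective hF hj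
  -- The diagram formed by tensoring `K → F → H` with `ker q → P → M` has an injective row at `P`
  -- and an injective column at `F`. The two implications are the same snake chase with rows and
  -- columns exchanged.
  constructor
  · intro h
    rw [injective_iff_map_eq_zero]
    intro t ht
    obtain ⟨t, rfl⟩ := balancedMap_surjective K hq t
    rw [← balancedMap_comm] at ht
    obtain ⟨f, hf⟩ := (balancedMap_exact F hjq hq _).1 ht
    have h0 : balancedMapLeft _ p f = 0 := by
      refine h ?_
      rw [balancedMap_comm, hf, map_zero]
      exact (balancedMapLeft_exact P hip hp _).2 ⟨t, rfl⟩
    obtain ⟨k, rfl⟩ := (balancedMapLeft_exact _ hip hp _).1 h0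
    rw [balancedMap_comm] at hf
    rw [← hKP hf]
    exact (balancedMap_exact K hjq hq _).2 ⟨k, rfl⟩
  · intro h
    rw [injective_iff_map_eq_zero]
    intro t ht
    obtain ⟨t, rfl⟩ := balancedMapLeft_surjective _ hp t
    rw [balancedMap_comm] at ht
    obtain ⟨f, hf⟩ := (balancedMapLeft_exact P hip hp _).1 ht
    have h0 : balancedMap K q f = 0 := by
      refine h ?_
      rw [← balancedMap_comm, hf, map_zero]
      exact (balancedMap_exact F hjq hq _).2 ⟨t, rfl⟩
    obtain ⟨k, rfl⟩ := (balancedMap_exact _ hjq hq _).1 h0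
    rw [← balancedMap_comm] at hf
    rw [← hFL hf]
    exact (balancedMapLeft_exact _ hip hp _).2 ⟨k, rfl⟩

lemma F1_iff (H : ModuleCat.{u} Rᵐᵒᵖ) : F1 R H ↔
    ∃ (K F : ModuleCat.{u} Rᵐᵒᵖ) (i : K →ₗ[Rᵐᵒᵖ] F) (p : F →ₗ[Rᵐᵒᵖ] H),
      Function.Injective i ∧ Function.Exact i p ∧ Function.Surjective p ∧
        IsFlatRight R F ∧ IsFlatRight R K := by
  constructor
  · rintro ⟨K, F, i, p, w, h, hF, hK⟩
    exact ⟨K, F, i.hom, p.hom, h.moduleCat_injective_f,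
      (ShortComplex.ShortExact.moduleCat_exact_iff_function_exact _).1 h.exact,
      h.moduleCat_surjective_g, hF, hK⟩
  · rintro ⟨K, F, i, p, hi, hip, hp, hF, hK⟩
    refine ⟨K, F, ModuleCat.ofHom i, ModuleCat.ofHom p,
      ModuleCat.hom_ext hip.linearMap_comp_eq_zero, ?_, hF, hK⟩
    exact
      { exact := (ShortComplex.ShortExact.moduleCat_exact_iff_function_exact _).2 hip
        mono_f := (ModuleCat.mono_iff_injective _).2 hi
        epi_g := (ModuleCat.epi_iff_surjective _).2 hp }

/-- A free presentation of a right module. -/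
lemma exists_free_presentation (S : Type u) [Ring S] (H : Type u) [AddCommGroup H] [Module S H] :
    ∃ p : (H →₀ S) →ₗ[S] H, Function.Surjective p :=
  ⟨Finsupp.linearCombination S id, Finsupp.linearCombination_id_surjective S H⟩

lemma exists_free_shortExact {S : Type u} [Ring S] (H : ModuleCat.{u} S) :
    ∃ (K F : ModuleCat.{u} S) (i : K →ₗ[S] F) (p : F →ₗ[S] H), Module.Free S F ∧
      Function.Injective i ∧ Function.Exact i p ∧ Function.Surjective p := by
  obtain ⟨p, hp⟩ := exists_free_presentation S H
  exact ⟨ModuleCat.of S (LinearMap.ker p), ModuleCat.of S (H →₀ S), (LinearMap.ker p).subtype, p,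
    inferInstanceAs (Module.Free S (H →₀ S)), Subtype.val_injective,
    LinearMap.exact_subtype_ker_map p, hp⟩

/-- If `Tor_1(H, L) = 0` for all submodules `L` of projective modules, then the kernel of a flat
presentation of `H` is flat. -/
lemma isFlatRight_ker {K F : ModuleCat.{u} Rᵐᵒᵖ} {i : K →ₗ[Rᵐᵒᵖ] F} (hF : IsFlatRight R F)
    (h : ∀ (P : Type u) [AddCommGroup P] [Module R P] [Module.Projective R P]
      (L : Submodule R P), Function.Injective (balancedMapLeft L i)) : IsFlatRight R K := by
  have key : ∀ (P : Type u) [AddCommGroup P] [Module R P] [Module.Projective R P]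
      (L : Submodule R P), Function.Injective (balancedMap K L.subtype) := by
    intro P _ _ _ L
    -- The injective composite `K ⊗ L → F ⊗ L → F ⊗ P` also factors through `K ⊗ P`.
    have h1 : Function.Injective (balancedMap F L.subtype) :=
      flat_injective hF Subtype.val_injective
    intro a b hab
    refine h P L (h1 ?_)
    rw [balancedMap_comm, balancedMap_comm, hab]
  rw [isFlatRight_iff]
  intro M N _ _ _ _ f hf
  obtain ⟨p, hp⟩ := exists_free_presentation R N
  -- An arbitrary inclusion `M → N` is pulled back to a submodule of a free cover of `N`, where
  -- `key` applies.
  let L : Submodule R (N →₀ R) := (LinearMap.range f).comap p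
  let e := LinearEquiv.ofInjective f hf
  let q : L →ₗ[R] M := e.symm.toLinearMap ∘ₗ (p.restrict (q := LinearMap.range f) fun x hx => hx)
  have hfq : f ∘ₗ q = p ∘ₗ L.subtype := by
    ext x
    have : e (q x) = p.restrict (q := LinearMap.range f) (fun x hx => hx) x :=
      e.apply_symm_apply _
    exact congrArg Subtype.val this
  have hq : Function.Surjective q := by
    intro m
    obtain ⟨x, hx⟩ := hp (f m)
    refine ⟨⟨x, m, hx.symm⟩, hf ?_⟩
    exact (LinearMap.congr_fun hfq _).trans hx
  rw [injective_iff_map_eq_zero]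
  intro t ht
  obtain ⟨t, rfl⟩ := balancedMap_surjective (R := R) (M := L) (N := M) (g := q) K hq t
  rw [← balancedMap_comp_apply, hfq, balancedMap_comp_apply] at ht
  obtain ⟨s, hs⟩ := (balancedMap_exact (M := LinearMap.ker p)
    (f := (LinearMap.ker p).subtype) K (LinearMap.exact_subtype_ker_map p) hp _).1 ht
  -- The kernel of the cover lies in `L` and dies in `M`, so a tensor coming from it contributes
  -- nothing to `K ⊗ M`.
  let j : LinearMap.ker p →ₗ[R] L := Submodule.inclusion fun x hx => by
    have : p x = 0 := hx
    simp [L, this]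
  have hj : balancedMap K j s = t := by
    refine key _ L ?_
    rw [← hs, ← balancedMap_comp_apply]
    rfl
  have hqj : q ∘ₗ j = 0 := by
    ext x
    refine hf ?_
    have := LinearMap.congr_fun hfq (j x)
    simp only [LinearMap.comp_apply] at this ⊢
    rw [this]
    exact (LinearMap.mem_ker.1 x.2).trans (map_zero f).symm
  rw [← hj, ← balancedMap_comp_apply, hqj]
  clear * -
  induction s using balancedTensor_induction with
  | zero => simp
  | tmul h m => simp [btmul_zero]
  | add x y hx hy => simp [hx, hy]

/-- Submodules of projective left modules are `F₁`-flat. -/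
lemma F1Flat_of_submodule (P : Type u) [AddCommGroup P] [Module R P] [Module.Projective R P]
    (L : Submodule R P) : F1Flat R (ModuleCat.of R L) := by
  intro H hH
  obtain ⟨K, F, i, p, hi, hip, hp, hF, hK⟩ := (F1_iff H).1 hH
  rw [isZero_tor_one_iff hF hi hip hp]
  -- Going through `K ⊗ P`, the map `K ⊗ L → F ⊗ P` is injective; it also factors through `F ⊗ L`.
  have h1 : Function.Injective (balancedMap K L.subtype) := flat_injective hK Subtype.val_injective
  have h2 : Function.Injective (balancedMapLeft P i) := balancedMapLeft_injective_of_projective hi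
  intro a b hab
  refine h1 (h2 ?_)
  rw [← balancedMap_comm, ← balancedMap_comm]
  exact congrArg _ hab

lemma isFlatRight_ker_of_hat {K F H : ModuleCat.{u} Rᵐᵒᵖ} {i : K →ₗ[Rᵐᵒᵖ] F}
    {p : F →ₗ[Rᵐᵒᵖ] H} (hF : IsFlatRight R F) (hi : Function.Injective i)
    (hip : Function.Exact i p) (hp : Function.Surjective p) (hH : hat (F1 R) H) :
    IsFlatRight R K :=
  isFlatRight_ker hF fun P _ _ _ L =>
    (isZero_tor_one_iff hF hi hip hp _).1 (hH (ModuleCat.of R L) (F1Flat_of_submodule P L))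

lemma le_hat (C : ObjectProperty (ModuleCat.{u} Rᵐᵒᵖ)) : C ≤ hat C :=
  fun H hH _ hM => hM H hH

lemma hat_F1 : hat (F1 R) = F1 R := by
  refine le_antisymm (fun H hH => ?_) (le_hat _)
  obtain ⟨K, F, i, p, hfree, hi, hip, hp⟩ := exists_free_shortExact H
  have hF : IsFlatRight R F := isFlatRight_of_projective F
  exact (F1_iff H).2 ⟨K, F, i, p, hi, hip, hp, hF, isFlatRight_ker_of_hat hF hi hip hp hH⟩

end Tor

/-! ### Matrix-flat modules and modules of projective dimension at most one -/

section MatrixFlat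

/-- Left multiplication by the matrix `A` is injective on column vectors over `R`. -/
def MulVecInjective {R : Type*} [Ring R] {s t : Type*} [Fintype s] (A : t → s → R) : Prop :=
  ∀ v : s → R, (∀ i, ∑ j, A i j * v j = 0) → v = 0

/-- The left modules `N` on which every matrix with `MulVecInjective` acts injectively. -/
def MatrixFlat (R : Type u) [Ring R] : ObjectProperty (ModuleCat.{u} R) := fun N =>
  ∀ (s t : ℕ) (A : Fin t → Fin s → R), MulVecInjective A →
    ∀ n : Fin s → N, (∀ i, ∑ j, A i j • n j = 0) → n = 0

variable {R : Type u} [Ring R]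

lemma MatrixFlat.eq_zero {N : ModuleCat.{u} R} (hN : MatrixFlat R N) {s t : Type*} [Fintype s]
    [Finite t] {A : t → s → R} (hA : MulVecInjective A) {n : s → N}
    (hn : ∀ i, ∑ j, A i j • n j = 0) : n = 0 := by
  have := Fintype.ofFinite t
  let e := Fintype.equivFin s
  let e' := Fintype.equivFin t
  have := hN _ _ (fun i j => A (e'.symm i) (e.symm j)) (fun v hv => ?_) (n ∘ e.symm) fun i => ?_
  · ext j
    simpa using congrFun this (e j)
  · have := hA (v ∘ e) fun i => by
      rw [← hv (e' i), ← e.sum_comp]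
      simp
    ext j
    simpa using congrFun this (e.symm j)
  · rw [← hn (e'.symm i), ← e.sum_comp]
    simp

/-- A tensor involves finitely many basis vectors, and their images involve finitely many
coordinates. The resulting finite block of `g` is still injective, since all discarded entries in
these columns are zero. -/
lemma MatrixFlat.injective_of_free {N : ModuleCat.{u} R} (hN : MatrixFlat R N) {V W : Type u}
    [AddCommGroup V] [Module Rᵐᵒᵖ V] [Module.Free Rᵐᵒᵖ V] [AddCommGroup W] [Module Rᵐᵒᵖ W]
    [Module.Free Rᵐᵒᵖ W] {g : V →ₗ[Rᵐᵒᵖ] W} (hg : Function.Injective g) :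
    Function.Injective (balancedMapLeft N g) := by
  classical
  let b := Module.Free.chooseBasis Rᵐᵒᵖ V
  let c := Module.Free.chooseBasis Rᵐᵒᵖ W
  rw [injective_iff_map_eq_zero]
  intro x hx
  obtain ⟨n, rfl⟩ := exists_finsupp_left b x
  let t := n.support.biUnion fun i => (c.repr (g (b i))).support
  have h0 : (fun i : n.support => n i) = 0 := by
    refine hN.eq_zero (s := n.support) (t := t)
      (A := fun j i => unop (c.repr (g (b i)) j)) (fun v hv => ?_) fun j => ?_
    · let w : V := ∑ i : n.support, op (v i) • b i
      have hw : w = 0 := by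
        refine hg (c.repr.injective (Finsupp.ext fun j => ?_))
        simp only [w, map_sum, map_smul, map_zero, Finsupp.coe_finsetSum, Finset.sum_apply,
          Finsupp.smul_apply, Finsupp.zero_apply, smul_eq_mul]
        by_cases hj : j ∈ t
        · refine unop_injective ?_
          simpa using hv ⟨j, hj⟩
        · refine Finset.sum_eq_zero fun i _ => ?_
          have : c.repr (g (b i)) j = 0 := by
            by_contra h
            exact hj (Finset.mem_biUnion.2 ⟨i, i.2, Finsupp.mem_support_iff.2 h⟩)
          rw [this, mul_zero]
      have hli := (b.linearIndependent.comp ((↑) : n.support → _) Subtype.val_injective)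
      have := Fintype.linearIndependent_iff.1 hli (fun i => op (v i)) hw
      ext i
      exact op_injective (this i)
    · have := congrArg (coordLeft N (c.coord j)) hx
      rw [map_finsuppSum, map_finsuppSum, Finsupp.sum, map_zero, ← Finset.sum_coe_sort] at this
      simpa using this
  have : n = 0 := by
    ext i
    by_cases hi : i ∈ n.support
    · exact congrFun h0 ⟨i, hi⟩
    · simpa using hi
  rw [this, Finsupp.sum_zero_index]

lemma MatrixFlat.injective_of_projective {N : ModuleCat.{u} R} (hN : MatrixFlat R N) {K F : Type u}
    [AddCommGroup K] [Module Rᵐᵒᵖ K] [Module.Projective Rᵐᵒᵖ K] [AddCommGroup F] [Module Rᵐᵒᵖ F]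
    [Module.Free Rᵐᵒᵖ F] {i : K →ₗ[Rᵐᵒᵖ] F} (hi : Function.Injective i) :
    Function.Injective (balancedMapLeft N i) := by
  obtain ⟨p, hp⟩ := exists_free_presentation Rᵐᵒᵖ K
  obtain ⟨s, hs⟩ := Module.projective_lifting_property p LinearMap.id hp
  have hs' : ∀ k, p (s k) = k := LinearMap.congr_fun hs
  -- The second component makes up for the kernel of `p`, so `g` is an injection of free modules,
  -- and it restricts to `i` along the section `s`.
  let g : (K →₀ Rᵐᵒᵖ) →ₗ[Rᵐᵒᵖ] F × (K →₀ Rᵐᵒᵖ) := (i ∘ₗ p).prod (LinearMap.id - s ∘ₗ p)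
  have hg : Function.Injective g := by
    rw [injective_iff_map_eq_zero]
    intro v hv
    have h1 : p v = 0 := hi (by simpa [g] using congrArg Prod.fst hv)
    simpa [g, h1] using congrArg Prod.snd hv
  have hgs : g ∘ₗ s = LinearMap.inl _ _ _ ∘ₗ i := by
    ext k
    · simp [g, hs']
    · simp [g, hs']
  rw [injective_iff_map_eq_zero]
  intro x hx
  have h1 : balancedMapLeft N s x = 0 := by
    refine hN.injective_of_free hg ?_
    rw [← balancedMapLeft_comp_apply, hgs, balancedMapLeft_comp_apply, hx, map_zero, map_zero]
  have h2 := balancedMapLeft_comp_apply p s x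
  rwa [hs, balancedMapLeft_id_apply, h1, map_zero] at h2

lemma shortExact_mk {S : Type u} [Ring S] {K F H : Type u} [AddCommGroup K] [Module S K]
    [AddCommGroup F] [Module S F] [AddCommGroup H] [Module S H] {i : K →ₗ[S] F} {p : F →ₗ[S] H}
    (hi : Function.Injective i) (hip : Function.Exact i p) (hp : Function.Surjective p) :
    (ShortComplex.mk (ModuleCat.ofHom i) (ModuleCat.ofHom p)
      (ModuleCat.hom_ext hip.linearMap_comp_eq_zero)).ShortExact where
  exact := (ShortComplex.ShortExact.moduleCat_exact_iff_function_exact _).2 hip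
  mono_f := (ModuleCat.mono_iff_injective _).2 hi
  epi_g := (ModuleCat.epi_iff_surjective _).2 hp

lemma P1_iff_of_presentation {K F : Type u} [AddCommGroup K] [Module Rᵐᵒᵖ K]
    [AddCommGroup F] [Module Rᵐᵒᵖ F] [Module.Projective Rᵐᵒᵖ F] {H : ModuleCat.{u} Rᵐᵒᵖ}
    {i : K →ₗ[Rᵐᵒᵖ] F} {p : F →ₗ[Rᵐᵒᵖ] H}
    (hi : Function.Injective i) (hip : Function.Exact i p) (hp : Function.Surjective p) :
    P1 R H ↔ Module.Projective Rᵐᵒᵖ K := by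
  have hS := shortExact_mk hi hip hp
  rw [IsProjective.iff_projective, projective_iff_hasProjectiveDimensionLT_one]
  exact hS.hasProjectiveDimensionLT_X₃_iff 0 ((IsProjective.iff_projective F).1 inferInstance)

lemma MatrixFlat.P1Flat {N : ModuleCat.{u} R} (hN : MatrixFlat R N) : P1Flat R N := by
  intro H hH
  obtain ⟨K, F, i, p, hfree, hi, hip, hp⟩ := exists_free_shortExact H
  have : Module.Projective Rᵐᵒᵖ K := (P1_iff_of_presentation hi hip hp).1 hH
  exact (isZero_tor_one_iff (isFlatRight_of_projective _) hi hip hp N).2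
    (hN.injective_of_projective hi)

variable (R) in
/-- Indices for the cokernels of injective maps between free right modules of finite rank. -/
def MatrixIndex : Type u :=
  Σ (s t : ℕ), {f : (Fin s →₀ Rᵐᵒᵖ) →ₗ[Rᵐᵒᵖ] (Fin t →₀ Rᵐᵒᵖ) // Function.Injective f}

/-- The cokernel of an injective map between free right modules of finite rank. -/
noncomputable abbrev matrixCokernel (a : MatrixIndex R) : ModuleCat.{u} Rᵐᵒᵖ :=
  ModuleCat.of Rᵐᵒᵖ ((Fin a.2.1 →₀ Rᵐᵒᵖ) ⧸ LinearMap.range a.2.2.1)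

lemma matrixCokernel_exact (a : MatrixIndex R) :
    Function.Exact a.2.2.1 (LinearMap.range a.2.2.1).mkQ :=
  LinearMap.exact_map_mkQ_range _

lemma P1_matrixCokernel (a : MatrixIndex R) : P1 R (matrixCokernel a) :=
  (P1_iff_of_presentation a.2.2.2 (matrixCokernel_exact a) (Submodule.mkQ_surjective _)).2
    inferInstance

lemma F1fp_matrixCokernel (a : MatrixIndex R) : F1fp R (matrixCokernel a) := by
  constructor
  · exact (F1_iff _).2 ⟨ModuleCat.of _ (Fin a.1 →₀ Rᵐᵒᵖ), ModuleCat.of _ (Fin a.2.1 →₀ Rᵐᵒᵖ),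
      a.2.2.1, (LinearMap.range a.2.2.1).mkQ, a.2.2.2, matrixCokernel_exact a,
      Submodule.mkQ_surjective _, isFlatRight_of_projective _, isFlatRight_of_projective _⟩
  · refine Module.finitePresentation_of_surjective (LinearMap.range a.2.2.1).mkQ
      (Submodule.mkQ_surjective _) ?_
    rw [Submodule.ker_mkQ]
    exact Module.Finite.fg_top.map a.2.2.1 |> fun h => by rwa [Submodule.map_top] at h

lemma isZero_tor_matrixCokernel (a : MatrixIndex R) (N : ModuleCat.{u} R) :
    IsZero (tor 1 (matrixCokernel a) N) ↔ Function.Injective (balancedMapLeft N a.2.2.1) :=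
  isZero_tor_one_iff (K := ModuleCat.of _ (Fin a.1 →₀ Rᵐᵒᵖ))
    (F := ModuleCat.of _ (Fin a.2.1 →₀ Rᵐᵒᵖ)) (isFlatRight_of_projective _) a.2.2.2
    (matrixCokernel_exact a) (Submodule.mkQ_surjective _) N

/-- A column `n` over `N` is the tensor `∑ e_j ⊗ n_j`, and the entries of `A n` are the coordinates
of its image under the map of free modules given by `A`. -/
lemma matrixFlat_of_tor {N : ModuleCat.{u} R}
    (hN : ∀ a : MatrixIndex R, IsZero (tor 1 (matrixCokernel a) N)) : MatrixFlat R N := by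
  intro s t A hA n hn
  let f : (Fin s →₀ Rᵐᵒᵖ) →ₗ[Rᵐᵒᵖ] (Fin t →₀ Rᵐᵒᵖ) := Finsupp.linearCombination Rᵐᵒᵖ
    fun j => Finsupp.equivFunOnFinite.symm fun i => op (A i j)
  have hf : Function.Injective f := by
    rw [injective_iff_map_eq_zero]
    intro v hv
    have := hA (fun j => unop (v j)) fun i => by
      have := DFunLike.congr_fun hv i
      rw [Finsupp.linearCombination_apply, Finsupp.sum_fintype _ _ (by simp)] at this
      exact op_injective (by simpa using this)
    ext j
    simpa using congrFun this j
  have hinj := (isZero_tor_matrixCokernel ⟨s, t, f, hf⟩ N).1 (hN _)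
  have h0 : ∑ j, btmul R (Finsupp.single j (1 : Rᵐᵒᵖ)) (n j) = 0 := by
    refine (injective_iff_map_eq_zero _).1 hinj _ ?_
    refine eq_zero_of_coordLeft Finsupp.basisSingleOne _ fun i => ?_
    rw [map_sum, map_sum]
    simpa [f] using hn i
  ext j
  have := congrArg (coordLeft N ((Finsupp.basisSingleOne (R := Rᵐᵒᵖ)).coord j)) h0
  rw [map_sum, Finset.sum_eq_single j] at this
  · simpa using this
  · intro i _ hij
    simp [hij]
  · simp

lemma P1Flat_eq : P1Flat R = MatrixFlat R :=
  le_antisymm (fun _ hN => matrixFlat_of_tor fun a => hN _ (P1_matrixCokernel a))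
    fun _ hN => MatrixFlat.P1Flat hN

end MatrixFlat

/-! ### The smallest submodule with matrix-flat quotient -/

section Torsion

variable {R : Type u} [Ring R] {V : Type u} [AddCommGroup V] [Module R V]

/-- The vector `u` is sent into `W` by a matrix acting injectively on column vectors. -/
def IsTorsionFamily (W : Submodule R V) {s : Type} [Fintype s] (u : s → V) : Prop :=
  ∃ (t : Type) (_ : Finite t) (A : t → s → R), MulVecInjective A ∧ ∀ i, ∑ j, A i j • u j ∈ W

/-- The elements of `V` occurring in a torsion family modulo `W`. -/
def matrixTorsionSet (W : Submodule R V) : Set V :=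
  {x | ∃ (s : Type) (_ : Fintype s) (u : s → V), IsTorsionFamily W u ∧ x ∈ Set.range u}

/-- The block diagonal sum of injective matrices is injective, so finitely many torsion elements can
be placed in one family with one matrix. -/
lemma exists_torsionFamily (W : Submodule R V) {ι : Type} [Fintype ι] {τ : ι → V}
    (hτ : ∀ l, τ l ∈ matrixTorsionSet W) :
    ∃ (s : Type) (_ : Fintype s) (u : s → V) (σ : ι → s), IsTorsionFamily W u ∧
      ∀ l, u (σ l) = τ l := by
  classical
  choose s _ u hu σ hσ using hτ
  choose t _ A hA hAu using hu
  refine ⟨Σ l, s l, inferInstance, fun x => u x.1 x.2, fun l => ⟨l, σ l⟩,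
    ⟨Σ l, t l, inferInstance,
      fun i j => if h : j.1 = i.1 then A i.1 i.2 (h ▸ j.2) else 0, ?_, ?_⟩, hσ⟩
  · intro v hv
    have h (l) : (fun j => v ⟨l, j⟩) = 0 := hA l _ fun i => by
      have := hv ⟨l, i⟩
      rw [Fintype.sum_sigma, Finset.sum_eq_single l] at this
      · simpa using this
      · intro l' _ hl
        simp [hl]
      · simp
    ext ⟨l, j⟩
    exact congrFun (h l) j
  · rintro ⟨l, i⟩
    rw [Fintype.sum_sigma, Finset.sum_eq_single l]
    · simpa using hAu l i
    · intro l' _ hl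
      simp [hl]
    · simp

/-- Torsion modulo torsion is torsion. If `A u` consists of entries of `w` and `B w` lies in `W`,
then the block triangular matrix with diagonal blocks `A` and `B` is injective and sends `(u, w)`
into `W`. Closure under sums and scalars, and matrix-flatness of the quotient, all follow from this.
-/
lemma mem_matrixTorsionSet_of_mulVecInjective (W : Submodule R V) {s t : Type} [Fintype s]
    [Fintype t] {A : t → s → R} (hA : MulVecInjective A) {u : s → V}
    (hu : ∀ i, ∑ j, A i j • u j ∈ matrixTorsionSet W) (j : s) : u j ∈ matrixTorsionSet W := by
  classical
  obtain ⟨s', _, w, σ, ⟨t', _, B, hB, hBw⟩, hσ⟩ := exists_torsionFamily W hu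
  refine ⟨s ⊕ s', inferInstance, Sum.elim u w, ⟨t ⊕ t', inferInstance,
    Sum.elim (fun i => Sum.elim (A i) fun b => if b = σ i then -1 else 0)
      (fun i => Sum.elim 0 (B i)), ?_, ?_⟩, Sum.inl j, rfl⟩
  · intro v hv
    have h1 : v ∘ Sum.inr = 0 := hB _ fun i => by simpa using hv (Sum.inr i)
    have h1' (b) : v (Sum.inr b) = 0 := congrFun h1 b
    have h2 : v ∘ Sum.inl = 0 := hA _ fun i => by simpa [h1'] using hv (Sum.inl i)
    ext (a | b)
    · exact congrFun h2 a
    · exact h1' b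
  · rintro (i | i)
    · simp [hσ]
    · simpa using hBw i

lemma subset_matrixTorsionSet (W : Submodule R V) {x : V} (hx : x ∈ W) :
    x ∈ matrixTorsionSet W :=
  ⟨Unit, inferInstance, fun _ => x, ⟨Unit, inferInstance, fun _ _ => 1,
    fun v hv => by ext; simpa using hv (), fun _ => by simpa using hx⟩, (), rfl⟩

/-- The smallest submodule containing `W` modulo which injective matrices act injectively. -/
def matrixTorsion (W : Submodule R V) : Submodule R V where
  carrier := matrixTorsionSet W
  zero_mem' := subset_matrixTorsionSet W W.zero_mem
  add_mem' {x y} hx hy := by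
    -- This unitriangular matrix sends `(x + y, x, y)` to `(0, x, y)`.
    refine mem_matrixTorsionSet_of_mulVecInjective W (s := Fin 3) (t := Fin 3)
      (A := ![![1, -1, -1], ![0, 1, 0], ![0, 0, 1]]) (u := ![x + y, x, y]) ?_ ?_ 0
    · intro v hv
      have h1 : v 1 = 0 := by simpa [Fin.sum_univ_three] using hv 1
      have h2 : v 2 = 0 := by simpa [Fin.sum_univ_three] using hv 2
      have h0 : v 0 = 0 := by simpa [Fin.sum_univ_three, h1, h2] using hv 0
      ext i
      fin_cases i <;> assumption
    · intro i
      fin_cases i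
      · simpa [Fin.sum_univ_three] using subset_matrixTorsionSet W W.zero_mem
      · simpa [Fin.sum_univ_three] using hx
      · simpa [Fin.sum_univ_three] using hy
  smul_mem' r x hx := by
    -- This unitriangular matrix sends `(r • x, x)` to `(0, x)`.
    refine mem_matrixTorsionSet_of_mulVecInjective W (s := Fin 2) (t := Fin 2)
      (A := ![![1, -r], ![0, 1]]) (u := ![r • x, x]) ?_ ?_ 0
    · intro v hv
      have h1 : v 1 = 0 := by simpa [Fin.sum_univ_two] using hv 1
      have h0 : v 0 = 0 := by simpa [Fin.sum_univ_two, h1] using hv 0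
      ext i
      fin_cases i <;> assumption
    · intro i
      fin_cases i
      · simpa [Fin.sum_univ_two] using subset_matrixTorsionSet W W.zero_mem
      · simpa [Fin.sum_univ_two] using hx

lemma matrixFlat_quotient_matrixTorsion (W : Submodule R V) :
    MatrixFlat R (ModuleCat.of R (V ⧸ matrixTorsion W)) := by
  intro s t A hA n hn
  obtain ⟨u, rfl⟩ : ∃ u : Fin s → V, (fun j => (matrixTorsion W).mkQ (u j)) = n := by
    choose u hu using fun j => Submodule.mkQ_surjective (matrixTorsion W) (n j)
    exact ⟨u, funext hu⟩
  ext j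
  refine (Submodule.Quotient.mk_eq_zero _).2 ?_
  refine mem_matrixTorsionSet_of_mulVecInjective W hA (fun i => ?_) j
  refine (Submodule.Quotient.mk_eq_zero (matrixTorsion W)).1 (Eq.trans ?_ (hn i))
  change (matrixTorsion W).mkQ _ = _
  simp only [map_sum, map_smul]

end Torsion

/-! ### Factoring maps through cokernels of injective matrices -/

section Factorization

variable {R : Type u} [Ring R]

lemma exists_sum_coordRight {H : Type u} [AddCommGroup H] [Module Rᵐᵒᵖ H] {V : Type u}
    [AddCommGroup V] [Module R V] (t : BalancedTensor R H V) :
    ∃ (ι : Type) (_ : Fintype ι) (h : ι → H) (v : ι → V), t = ∑ l, btmul R (h l) (v l) := by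
  induction t using balancedTensor_induction with
  | zero => exact ⟨Empty, inferInstance, Empty.elim, Empty.elim, by simp⟩
  | tmul h m => exact ⟨Unit, inferInstance, fun _ => h, fun _ => m, by simp⟩
  | add x y hx hy =>
    obtain ⟨⟨ι, _, h, v, rfl⟩, ι', _, h', v', rfl⟩ := hx, hy
    exact ⟨ι ⊕ ι', inferInstance, Sum.elim h h', Sum.elim v v', by simp⟩

/-- If `K ⊗ (Rⁿ / U) → F ⊗ (Rⁿ / U)` is injective, a vector over `K` which is a combination over
`F` of rows in `U` is a combination over `K` of elements of `U`. -/
lemma exists_combination {K F : Type u} [AddCommGroup K] [Module Rᵐᵒᵖ K] [AddCommGroup F]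
    [Module Rᵐᵒᵖ F] {i : K →ₗ[Rᵐᵒᵖ] F} {m n : ℕ} {U : Submodule R (Fin n → R)}
    (hU : Function.Injective (balancedMapLeft ((Fin n → R) ⧸ U) i))
    {D : Fin m → Fin n → R} (hD : ∀ a, D a ∈ U) {φ : Fin m → F} {k : Fin n → K}
    (hk : ∀ j, i (k j) = ∑ a, op (D a j) • φ a) :
    ∃ (ι : Type) (_ : Fintype ι) (κ : ι → K) (τ : ι → Fin n → R), (∀ l, τ l ∈ U) ∧
      ∀ j, k j = ∑ l, op (τ l j) • κ l := by
  -- In `F ⊗ (Rⁿ / U)` the image of `y` is `∑ φ_a ⊗ D_a = 0`. Hence `y` comes from `K ⊗ U`, and its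
  -- coordinates give the combination.
  let y : BalancedTensor R K (Fin n → R) := ∑ j, btmul R (k j) (Pi.single j 1)
  have hy : balancedMap K U.mkQ y = 0 := by
    refine (injective_iff_map_eq_zero _).1 hU _ ?_
    have h1 (a) : ∑ j, D a j • U.mkQ (Pi.single j 1) = 0 := by
      have : D a = ∑ j, D a j • Pi.single j (1 : R) := pi_eq_sum_univ' (D a)
      simp only [← map_smul]
      rw [← map_sum, ← this]
      exact (Submodule.Quotient.mk_eq_zero _).2 (hD a)
    simp only [y, map_sum, balancedMap_btmul, balancedMapLeft_btmul, hk, sum_btmul, ← btmul_smul]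
    rw [Finset.sum_comm]
    simp only [← btmul_sum, h1, btmul_zero, Finset.sum_const_zero]
  obtain ⟨z, hz⟩ := (balancedMap_exact (M := U) (f := U.subtype) K
    (LinearMap.exact_subtype_mkQ U) (Submodule.mkQ_surjective U) y).1 hy
  obtain ⟨ι, _, κ, τ, rfl⟩ := exists_sum_coordRight z
  refine ⟨ι, inferInstance, κ, fun l => τ l, fun l => (τ l).2, fun j => ?_⟩
  have := congrArg (coordRight K (LinearMap.proj j)) hz
  simp only [y, map_sum, balancedMap_btmul, coordRight_btmul] at this
  rw [Finset.sum_eq_single j] at this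
  · simpa using this.symm
  · intro j' _ hj
    simp [hj.symm]
  · simp

lemma exists_relations {S : Type u} [Ring S] (Z : Type u) [AddCommGroup Z] [Module S Z]
    [Module.FinitePresentation S Z] :
    ∃ (m n : ℕ) (d : Fin n → Fin m → S) (π : (Fin m → S) →ₗ[S] Z), Function.Surjective π ∧
      LinearMap.ker π = Submodule.span S (Set.range d) := by
  obtain ⟨m, L, e, hL⟩ := Module.FinitePresentation.exists_fin S Z
  obtain ⟨n, d, rfl⟩ := Submodule.fg_iff_exists_fin_generating_family.1 hL
  refine ⟨m, n, d, e.symm.toLinearMap ∘ₗ Submodule.mkQ _,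
    e.symm.surjective.comp (Submodule.mkQ_surjective _), ?_⟩
  rw [LinearMap.ker_comp, LinearEquiv.ker, ← LinearMap.ker, Submodule.ker_mkQ]

lemma exists_factorization {S : Type u} [Ring S] {Z Y : Type u} [AddCommGroup Z] [Module S Z]
    [AddCommGroup Y] [Module S Y] {m n : ℕ} {d : Fin n → Fin m → S} {π : (Fin m → S) →ₗ[S] Z}
    (hπ : Function.Surjective π) (hd : LinearMap.ker π = Submodule.span S (Set.range d))
    (y : Fin m → Y) (hy : ∀ j, ∑ a, d j a • y a = 0) :
    ∃ g : Z →ₗ[S] Y, ∀ a, g (π (Pi.single a 1)) = y a := by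
  let ψ : (Fin m → S) →ₗ[S] Y := Fintype.linearCombination S y
  have hψ : LinearMap.ker π ≤ LinearMap.ker ψ := by
    rw [hd, Submodule.span_le]
    rintro _ ⟨j, rfl⟩
    exact hy j
  refine ⟨(LinearMap.ker π).liftQ ψ hψ ∘ₗ (π.quotKerEquivOfSurjective hπ).symm.toLinearMap,
    fun a => ?_⟩
  have : (π.quotKerEquivOfSurjective hπ).symm (π (Pi.single a 1)) =
      (LinearMap.ker π).mkQ (Pi.single a 1) := by
    rw [LinearEquiv.symm_apply_eq]
    rfl
  simp [this, ψ]

lemma hom_ext_of_relations {S : Type u} [Ring S] {Z Y : Type u} [AddCommGroup Z] [Module S Z]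
    [AddCommGroup Y] [Module S Y] {m : ℕ} {π : (Fin m → S) →ₗ[S] Z}
    (hπ : Function.Surjective π) {f g : Z →ₗ[S] Y}
    (h : ∀ a, f (π (Pi.single a 1)) = g (π (Pi.single a 1))) : f = g := by
  have : f ∘ₗ π = g ∘ₗ π := by
    refine LinearMap.pi_ext' fun a => LinearMap.ext_ring (h a)
  exact (LinearMap.cancel_right hπ).1 this

lemma isZero_tor_of_flat {H : ModuleCat.{u} Rᵐᵒᵖ} (hH : IsFlatRight R H) (M : ModuleCat.{u} R) :
    IsZero (tor 1 H M) := by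
  obtain ⟨P, p, _, _, h⟩ := exists_projective_presentation_tor M
  exact (h H).2 (flat_injective hH Subtype.val_injective)

/-- Finitely presented flat modules are projective. -/
lemma projective_of_flat (Z : ModuleCat.{u} Rᵐᵒᵖ) (hZ : IsFlatRight R Z)
    [Module.FinitePresentation Rᵐᵒᵖ Z] : Module.Projective Rᵐᵒᵖ Z := by
  obtain ⟨m, n, d, π, hπ, hd⟩ := exists_relations (S := Rᵐᵒᵖ) Z
  obtain ⟨K, i, hi, hex⟩ : ∃ (K : ModuleCat.{u} Rᵐᵒᵖ) (i : K →ₗ[Rᵐᵒᵖ] (Fin m → Rᵐᵒᵖ)),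
      Function.Injective i ∧ Function.Exact i π :=
    ⟨ModuleCat.of _ (LinearMap.ker π), (LinearMap.ker π).subtype, Subtype.val_injective,
      LinearMap.exact_subtype_ker_map π⟩
  let D : Fin m → Fin n → R := fun a j => unop (d j a)
  -- Flatness is tested on the quotient by the row space of the relation matrix. It rewrites the
  -- relations `k j` as combinations over `K` of the rows `D a`, which is the correction needed to
  -- split `π`.
  let U : Submodule R (Fin n → R) := Submodule.span R (Set.range D)
  have hinj := (isZero_tor_one_iff (F := ModuleCat.of Rᵐᵒᵖ (Fin m → Rᵐᵒᵖ))
    (isFlatRight_of_projective _) hi hex hπ (ModuleCat.of R (_ ⧸ U))).1 (isZero_tor_of_flat hZ _)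
  choose k hk using fun j => (hex (d j)).1 (LinearMap.mem_ker.1
    (hd ▸ Submodule.subset_span ⟨j, rfl⟩))
  have hsum (x : Fin m → Rᵐᵒᵖ) : x = ∑ a, x a • Pi.single a (1 : Rᵐᵒᵖ) := pi_eq_sum_univ' x
  obtain ⟨ι, _, κ, τ, hτ, hkτ⟩ := exists_combination (i := i) (U := U) hinj
    (fun a => Submodule.subset_span ⟨a, rfl⟩) (φ := fun a => Pi.single a 1) (k := k)
    fun j => (hk j).trans (hsum (d j))
  choose c hc using fun l => (Submodule.mem_span_range_iff_exists_fun R).1 (hτ l)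
  obtain ⟨g, hg⟩ := exists_factorization hπ hd
    (fun a => Pi.single a 1 - i (∑ l, op (c l a) • κ l)) fun j => by
      have h1 : k j = ∑ a, d j a • ∑ l, op (c l a) • κ l := by
        rw [hkτ]
        simp only [Finset.smul_sum]
        rw [Finset.sum_comm]
        refine Finset.sum_congr rfl fun l _ => ?_
        rw [← hc l]
        simp [Finset.sum_smul, mul_smul, D]
      simp only [smul_sub, Finset.sum_sub_distrib]
      have h2 := congrArg i h1
      rw [hk, map_sum] at h2
      simp only [map_smul] at h2
      rw [← hsum, sub_eq_zero]
      exact h2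
  refine Module.Projective.of_split g π (hom_ext_of_relations hπ fun a => ?_)
  simp [hg, hex.apply_apply_eq_zero]

/-- A finite family in a free module lies in a free submodule of finite rank. -/
lemma exists_finite_free {S : Type u} [Ring S] {F : Type u} [AddCommGroup F] [Module S F]
    [Module.Free S F] {ι : Type*} [Finite ι] (y : ι → F) :
    ∃ (r : ℕ) (j : (Fin r →₀ S) →ₗ[S] F) (x : ι → Fin r →₀ S), Function.Injective j ∧
      ∀ l, j (x l) = y l := by
  classical
  have := Fintype.ofFinite ι
  let b := Module.Free.chooseBasis S F
  let B : Finset (Module.Free.ChooseBasisIndex S F) :=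
    Finset.univ.biUnion fun l => (b.repr (y l)).support
  let e := B.equivFin
  let w : Fin B.card → F := fun a => b (e.symm a)
  have hw : LinearIndependent S w :=
    b.linearIndependent.comp _ (Subtype.val_injective.comp e.symm.injective)
  have hy (l) : y l ∈ LinearMap.range (Finsupp.linearCombination S w) := by
    rw [Finsupp.range_linearCombination, ← b.linearCombination_repr (y l),
      Finsupp.linearCombination_apply]
    refine Submodule.sum_mem _ fun a ha => Submodule.smul_mem _ _ (Submodule.subset_span ?_)
    exact ⟨e ⟨a, Finset.mem_biUnion.2 ⟨l, Finset.mem_univ _, ha⟩⟩, by simp [w]⟩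
  choose x hx using hy
  exact ⟨_, Finsupp.linearCombination S w, x, hw, hx⟩

lemma exists_matrixCokernel_equiv {V W : Type u} [AddCommGroup V] [Module Rᵐᵒᵖ V]
    [Module.Free Rᵐᵒᵖ V] [Module.Finite Rᵐᵒᵖ V] [AddCommGroup W] [Module Rᵐᵒᵖ W]
    [Module.Free Rᵐᵒᵖ W] [Module.Finite Rᵐᵒᵖ W] {g : V →ₗ[Rᵐᵒᵖ] W} (hg : Function.Injective g) :
    ∃ a : MatrixIndex R, Nonempty ((W ⧸ LinearMap.range g) ≃ₗ[Rᵐᵒᵖ] matrixCokernel a) := by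
  let e : V ≃ₗ[Rᵐᵒᵖ] _ :=
    ((Module.Free.chooseBasis Rᵐᵒᵖ V).reindex (Fintype.equivFin _)).repr
  let e' : W ≃ₗ[Rᵐᵒᵖ] _ :=
    ((Module.Free.chooseBasis Rᵐᵒᵖ W).reindex (Fintype.equivFin _)).repr
  refine ⟨⟨_, _, e'.toLinearMap ∘ₗ g ∘ₗ e.symm.toLinearMap,
    e'.injective.comp (hg.comp e.symm.injective)⟩, ⟨Submodule.Quotient.equiv _ _ e' ?_⟩⟩
  rw [LinearMap.range_comp, LinearMap.range_comp, LinearEquiv.range, Submodule.map_top]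

/-- Modules which are Tor-orthogonal to all matrix-flat modules: every homomorphism from a finitely
presented module factors through the cokernel of an injective matrix. -/
lemma exists_factorization_matrixCokernel {X : ModuleCat.{u} Rᵐᵒᵖ}
    (hX : torLeftOrthogonal (MatrixFlat R) X) {Z : ModuleCat.{u} Rᵐᵒᵖ}
    (hZ : Module.FinitePresentation Rᵐᵒᵖ Z) (f : Z →ₗ[Rᵐᵒᵖ] X) :
    ∃ (a : MatrixIndex R) (g : Z →ₗ[Rᵐᵒᵖ] matrixCokernel a) (h : matrixCokernel a →ₗ[Rᵐᵒᵖ] X),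
      h ∘ₗ g = f := by
  classical
  obtain ⟨m, n, d, π, hπ, hd⟩ := exists_relations (S := Rᵐᵒᵖ) Z
  obtain ⟨K, F, i, p, _, hi, hex, hp⟩ := exists_free_shortExact X
  choose φ hφ using fun a => hp (f (π (Pi.single a 1)))
  let D : Fin m → Fin n → R := fun a j => unop (d j a)
  have hφd (j) : p (∑ a, op (D a j) • φ a) = 0 := by
    have h1 : π (∑ a, d j a • Pi.single a (1 : Rᵐᵒᵖ)) = 0 := by
      rw [← pi_eq_sum_univ' (d j)]
      exact LinearMap.mem_ker.1 (hd ▸ Submodule.subset_span ⟨j, rfl⟩)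
    have h2 := congrArg f h1
    simpa only [map_sum, map_smul, hφ, map_zero, D, op_unop] using h2
  choose k hk using fun j => (hex _).1 (hφd j)
  -- The row space itself need not have a matrix-flat quotient, so the hypothesis on `X` is applied
  -- to its matrix torsion closure.
  let W : Submodule R (Fin n → R) := Submodule.span R (Set.range D)
  have hinj := (isZero_tor_one_iff (isFlatRight_of_projective F) hi hex hp _).1
    (hX _ (matrixFlat_quotient_matrixTorsion W))
  obtain ⟨ι, _, κ, τ, hτ, hkτ⟩ := exists_combination (i := i) (U := matrixTorsion W) hinj
    (fun a => subset_matrixTorsionSet W (Submodule.subset_span ⟨a, rfl⟩)) hk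
  obtain ⟨s, _, u, σ, ⟨t, _, A, hA, hAu⟩, hσ⟩ := exists_torsionFamily W hτ
  choose c hc using fun q => (Submodule.mem_span_range_iff_exists_fun R).1 (hAu q)
  -- Coefficients with the same position in the torsion family are collected, so that `k` is a
  -- combination of the rows `u b`.
  let κ' : s → K := fun b => ∑ l with σ l = b, κ l
  have hkκ (j) : k j = ∑ b, op (u b j) • κ' b := by
    rw [hkτ, ← Finset.sum_fiberwise _ σ]
    refine Finset.sum_congr rfl fun b _ => ?_
    rw [Finset.smul_sum]
    refine Finset.sum_congr rfl fun l hl => ?_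
    rw [← hσ l, (Finset.mem_filter.1 hl).2]
  obtain ⟨r, ε, x, hε, hx⟩ := exists_finite_free (S := Rᵐᵒᵖ) (Sum.elim φ fun b => i (κ' b))
  have := Fintype.ofFinite t
  let g₁ : (s → Rᵐᵒᵖ) →ₗ[Rᵐᵒᵖ] (Fin r →₀ Rᵐᵒᵖ) :=
    Fintype.linearCombination Rᵐᵒᵖ fun b => x (Sum.inr b)
  let g₂ : (s → Rᵐᵒᵖ) →ₗ[Rᵐᵒᵖ] (t → Rᵐᵒᵖ) :=
    Fintype.linearCombination Rᵐᵒᵖ fun b q => op (A q b)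
  -- The component `g₂` is the matrix `A`, so `g` is injective whatever `g₁` is; `g₁` records the
  -- elements `κ'` of `K` inside a finite free part of `F`.
  let g := g₁.prod g₂
  have hg : Function.Injective g := by
    rw [injective_iff_map_eq_zero]
    intro v hv
    have h1 := hA (fun b => unop (v b)) fun q => by
      have := congrFun (congrArg Prod.snd hv) q
      refine op_injective ?_
      simpa [g, g₂, Fintype.linearCombination_apply] using this
    ext b
    simpa using congrFun h1 b
  obtain ⟨a, ⟨e⟩⟩ := exists_matrixCokernel_equiv hg
  -- The `a`-th generator goes to the class of `(φ_a, c_a)`. By `k = ∑ u_b κ'_b` and `A u = c D`,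
  -- the `j`-th relation becomes the image under `g` of the `j`-th column of `u`.
  obtain ⟨γ, hγ⟩ := exists_factorization hπ hd
    (fun a => (LinearMap.range g).mkQ (x (Sum.inl a), fun q => op (c q a))) fun j => by
      simp only [← map_smul]
      rw [← map_sum]
      refine (Submodule.Quotient.mk_eq_zero _).2 ⟨fun b => op (u b j), ?_⟩
      refine Prod.ext (hε ?_) (funext fun q => ?_)
      · simp only [g, g₁, LinearMap.prod_apply, Function.prod_apply,
          Fintype.linearCombination_apply, map_sum, map_smul, hx, Sum.elim_inr, Prod.fst_sum,
          Prod.smul_fst, Sum.elim_inl]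
        simp only [← map_smul]
        rw [← map_sum, ← hkκ, hk]
        simp [D]
      · have := congrFun (hc q) j
        simp only [g, g₂, LinearMap.prod_apply, Function.prod_apply,
          Fintype.linearCombination_apply, Prod.snd_sum, Prod.smul_snd, Finset.sum_apply,
          Pi.smul_apply, smul_eq_mul] at this ⊢
        refine unop_injective ?_
        simpa [D] using this.symm
  -- The return map forgets the second component and applies `p`; it kills the range of `g` because
  -- the first components come from `K`.
  have hker : LinearMap.range g ≤ LinearMap.ker (p ∘ₗ ε ∘ₗ LinearMap.fst _ _ _) := by
    rintro _ ⟨v, rfl⟩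
    simp [g, g₁, Fintype.linearCombination_apply, hx, hex.apply_apply_eq_zero]
  refine ⟨a, e.toLinearMap ∘ₗ γ, (LinearMap.range g).liftQ _ hker ∘ₗ e.symm.toLinearMap,
    hom_ext_of_relations hπ fun a => ?_⟩
  simp [hγ, hx, hφ]

end Factorization

/-! ### Direct limits from factorization of maps -/

section DirectLimit

variable {S : Type u} [Ring S] {I : Type u} {C : I → ModuleCat.{u} S} {X : ModuleCat.{u} S}

/-- Every homomorphism from a finitely presented module to `X` factors through some `C i`. -/
def FactorsThrough (C : I → ModuleCat.{u} S) (X : ModuleCat.{u} S) : Prop :=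
  ∀ Z : ModuleCat.{u} S, Module.FinitePresentation S Z → ∀ f : Z →ₗ[S] X,
    ∃ (i : I) (g : Z →ₗ[S] C i) (h : C i →ₗ[S] X), h ∘ₗ g = f

/-- The homomorphisms `C i → X`. -/
structure OverFamily (C : I → ModuleCat.{u} S) (X : ModuleCat.{u} S) : Type u where
  /-- The index of the source. -/
  idx : I
  /-- The homomorphism. -/
  hom : C idx →ₗ[S] X

/-- Morphisms in `OverFamily C X` are the homomorphisms over `X`. -/
instance : SmallCategory (OverFamily C X) where
  Hom j k := {φ : C j.idx →ₗ[S] C k.idx // k.hom ∘ₗ φ = j.hom}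
  id j := ⟨LinearMap.id, rfl⟩
  comp φ ψ := ⟨ψ.1 ∘ₗ φ.1, by rw [← LinearMap.comp_assoc, ψ.2, φ.2]⟩

/-- The tautological diagram on `OverFamily C X`. -/
abbrev overFamilyDiagram (C : I → ModuleCat.{u} S) (X : ModuleCat.{u} S) :
    OverFamily C X ⥤ ModuleCat.{u} S where
  obj j := C j.idx
  map φ := ModuleCat.ofHom φ.1

/-- The tautological cocone on `overFamilyDiagram C X`. -/
def overFamilyCocone (C : I → ModuleCat.{u} S) (X : ModuleCat.{u} S) :
    Cocone (overFamilyDiagram C X) where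
  pt := X
  ι := { app := fun j => ModuleCat.ofHom j.hom
         naturality := fun _ _ φ => ModuleCat.hom_ext φ.2 }

variable (hC : ∀ i, Module.FinitePresentation S (C i))
include hC

/-- The quotient by a finitely generated submodule is again finitely presented, so the induced map
to `X` factors through the family. This gives both the coequalizing morphisms for filteredness and
the injectivity of the comparison map. -/
lemma FactorsThrough.exists_hom_apply_eq_zero (hX : FactorsThrough C X) (j : OverFamily C X)
    {L : Submodule S (C j.idx)} (hL : L.FG) (h : L ≤ LinearMap.ker j.hom) :
    ∃ (k : OverFamily C X) (φ : j ⟶ k), ∀ x ∈ L, φ.1 x = 0 := by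
  have := hC j.idx
  have : Module.FinitePresentation S (C j.idx ⧸ L) :=
    Module.finitePresentation_of_surjective L.mkQ (Submodule.mkQ_surjective L)
      (by rwa [Submodule.ker_mkQ])
  obtain ⟨i, g, f, hf⟩ := hX (ModuleCat.of S (C j.idx ⧸ L)) this (L.liftQ _ h)
  let q : C j.idx →ₗ[S] ModuleCat.of S (C j.idx ⧸ L) := L.mkQ
  refine ⟨⟨i, f⟩, ⟨g ∘ₗ q, ?_⟩, fun x hx => ?_⟩
  · rw [← LinearMap.comp_assoc, hf]
    exact L.liftQ_mkQ _ h
  · exact (congrArg g ((Submodule.Quotient.mk_eq_zero L).2 hx)).trans (map_zero g)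

lemma FactorsThrough.isFiltered (hX : FactorsThrough C X) : IsFiltered (OverFamily C X) where
  cocone_objs j k := by
    have := hC j.idx
    have := hC k.idx
    obtain ⟨i, g, h, hgh⟩ := hX (ModuleCat.of S (C j.idx × C k.idx))
      (inferInstanceAs (Module.FinitePresentation S (C j.idx × C k.idx)))
      (LinearMap.coprod j.hom k.hom)
    have hgh' := LinearMap.congr_fun hgh
    refine ⟨⟨i, h⟩, ⟨g ∘ₗ LinearMap.inl S (C j.idx) (C k.idx), LinearMap.ext fun x => ?_⟩,
      ⟨g ∘ₗ LinearMap.inr S (C j.idx) (C k.idx), LinearMap.ext fun x => ?_⟩, trivial⟩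
    · exact (hgh' (x, 0)).trans (by simp)
    · exact (hgh' (0, x)).trans (by simp)
  cocone_maps j k φ ψ := by
    have := hC j.idx
    obtain ⟨l, χ, hχ⟩ := hX.exists_hom_apply_eq_zero hC k (L := LinearMap.range (φ.1 - ψ.1))
      (by
        rw [← Submodule.map_top]
        exact Module.Finite.fg_top.map _)
      (by
        rintro _ ⟨x, rfl⟩
        have h1 := LinearMap.congr_fun φ.2 x
        have h2 := LinearMap.congr_fun ψ.2 x
        rw [LinearMap.comp_apply] at h1 h2
        rw [LinearMap.mem_ker, LinearMap.sub_apply, map_sub, h1, h2, sub_self])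
    refine ⟨l, χ, Subtype.ext (LinearMap.ext fun x => ?_)⟩
    have := hχ _ ⟨x, rfl⟩
    rw [LinearMap.sub_apply, map_sub, sub_eq_zero] at this
    exact this
  nonempty := by
    obtain ⟨i, g, h, -⟩ := hX (ModuleCat.of S PUnit) (inferInstanceAs
      (Module.FinitePresentation S PUnit.{u + 1})) 0
    exact ⟨⟨i, h⟩⟩

lemma FactorsThrough.isColimit (hX : FactorsThrough C X) :
    Nonempty (IsColimit (overFamilyCocone C X)) := by
  have := hX.isFiltered hC
  let D := overFamilyDiagram C X
  let δ : colimit D ⟶ X := colimit.desc D (overFamilyCocone C X)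
  have hδ (j : OverFamily C X) (a : C j.idx) : δ.hom ((colimit.ι D j).hom a) = j.hom a :=
    LinearMap.congr_fun
      (congrArg ModuleCat.Hom.hom (colimit.ι_desc (overFamilyCocone C X) j)) a
  have hinj : Function.Injective δ.hom := by
    rw [injective_iff_map_eq_zero]
    intro y hy
    obtain ⟨j, a, rfl⟩ := Concrete.colimit_exists_rep D y
    have hy' : j.hom a = 0 := (hδ j a).symm.trans hy
    obtain ⟨k, φ, hφ⟩ := hX.exists_hom_apply_eq_zero hC j (L := Submodule.span S {a})
      (Submodule.fg_span_singleton a) (by rwa [Submodule.span_singleton_le_iff_mem])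
    have h1 := LinearMap.congr_fun (congrArg ModuleCat.Hom.hom (colimit.w D φ)) a
    refine h1.symm.trans ?_
    exact (congrArg (colimit.ι D k).hom (hφ a (Submodule.mem_span_singleton_self a))).trans
      (map_zero _)
  have hsurj : Function.Surjective δ.hom := by
    intro x
    obtain ⟨i, g, h, hgh⟩ := hX (ModuleCat.of S S)
      (inferInstanceAs (Module.FinitePresentation S S)) (LinearMap.toSpanSingleton S X x)
    refine ⟨(colimit.ι D ⟨i, h⟩).hom (g (1 : S)), (hδ _ _).trans ?_⟩
    exact (LinearMap.congr_fun hgh (1 : S)).trans (one_smul S x)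
  have : IsIso δ := (ConcreteCategory.isIso_iff_bijective δ).2 ⟨hinj, hsurj⟩
  exact ⟨IsColimit.ofPointIso (colimit.isColimit D) (i := this)⟩

/-- A module is a direct limit of modules from a family of finitely presented modules if all
homomorphisms from finitely presented modules factor through the family. -/
lemma FactorsThrough.exists_colimitPresentation (hX : FactorsThrough C X) :
    ∃ (ι : Type u) (_ : PartialOrder ι) (_ : IsDirectedOrder ι) (_ : Nonempty ι)
      (pres : ColimitPresentation ι X), ∀ k, ∃ i, pres.diag.obj k = C i := by
  have := hX.isFiltered hC
  obtain ⟨hc⟩ := hX.isColimit hC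
  obtain ⟨ι, _, _, _, F, _⟩ := IsFiltered.exists_directed (OverFamily C X)
  let pres : ColimitPresentation (OverFamily C X) X := ⟨_, _, hc⟩
  exact ⟨ι, inferInstance, inferInstance, inferInstance, pres.reindex F,
    fun k => ⟨(F.obj k).idx, rfl⟩⟩

end DirectLimit

/-! ### Tor and direct limits -/

section TorDirectLimit

variable {R : Type u} [Ring R]

/-- The functor `- ⊗_R M` from right `R`-modules to abelian groups. -/
def tensorRight (M : Type u) [AddCommGroup M] [Module R M] :
    ModuleCat.{u} Rᵐᵒᵖ ⥤ AddCommGrpCat.{u} where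
  obj H := AddCommGrpCat.of (BalancedTensor R H M)
  map f := AddCommGrpCat.ofHom (balancedMapLeft M f.hom).toAddMonoidHom
  map_id _ := AddCommGrpCat.hom_ext (AddMonoidHom.ext balancedMapLeft_id_apply)
  map_comp f g :=
    AddCommGrpCat.hom_ext (AddMonoidHom.ext (balancedMapLeft_comp_apply g.hom f.hom))

/-- The additive maps from a left module to an abelian group, as a right module. -/
def RightHom (M A : Type u) [AddCommGroup M] [AddCommGroup A] : Type u := M →+ A

instance (M A : Type u) [AddCommGroup M] [AddCommGroup A] : AddCommGroup (RightHom M A) :=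
  inferInstanceAs (AddCommGroup (M →+ A))

instance (M A : Type u) [AddCommGroup M] [Module R M] [AddCommGroup A] :
    Module Rᵐᵒᵖ (RightHom M A) where
  smul r φ := AddMonoidHom.comp (M := M) φ (DistribSMul.toAddMonoidHom M (unop r))
  one_smul φ := by
    refine AddMonoidHom.ext (M := M) (N := A) fun m => ?_
    exact congrArg (DFunLike.coe (F := M →+ A) φ) (one_smul R m)
  mul_smul r s φ := by
    refine AddMonoidHom.ext (M := M) (N := A) fun m => ?_
    exact congrArg (DFunLike.coe (F := M →+ A) φ) (mul_smul (unop s) (unop r) m)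
  smul_zero r := rfl
  smul_add r φ ψ := rfl
  add_smul r s φ := by
    refine AddMonoidHom.ext (M := M) (N := A) fun m => ?_
    refine (congrArg (DFunLike.coe (F := M →+ A) φ) (add_smul (unop r) (unop s) m)).trans ?_
    exact map_add (F := M →+ A) φ _ _
  zero_smul φ := by
    refine AddMonoidHom.ext (M := M) (N := A) fun m => ?_
    refine (congrArg (DFunLike.coe (F := M →+ A) φ) (zero_smul R m)).trans ?_
    exact map_zero (F := M →+ A) φ

variable {ι : Type u} [PartialOrder ι] [IsDirectedOrder ι] [Nonempty ι] {X : ModuleCat.{u} Rᵐᵒᵖ}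
  (pres : ColimitPresentation ι X) (M : Type u) [AddCommGroup M] [Module R M]

lemma exists_balancedTensor_rep (t : BalancedTensor R X M) :
    ∃ i, ∃ s : BalancedTensor R (pres.diag.obj i) M,
      balancedMapLeft M (pres.ι.app i).hom s = t := by
  induction t using balancedTensor_induction with
  | zero => exact ⟨Classical.arbitrary ι, 0, map_zero _⟩
  | tmul h m =>
    obtain ⟨i, x, hx⟩ := Concrete.isColimit_exists_rep pres.diag pres.isColimit h
    exact ⟨i, btmul R x m, congrArg (fun h => btmul R h m) hx⟩
  | add x y hx hy =>
    obtain ⟨⟨i, x, rfl⟩, j, y, rfl⟩ := hx, hy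
    obtain ⟨k, hik, hjk⟩ := exists_ge_ge i j
    refine ⟨k, balancedMapLeft M (pres.diag.map (homOfLE hik)).hom x +
      balancedMapLeft M (pres.diag.map (homOfLE hjk)).hom y, ?_⟩
    rw [map_add, ← balancedMapLeft_comp_apply, ← balancedMapLeft_comp_apply,
      ← ModuleCat.hom_comp, ← ModuleCat.hom_comp, pres.w, pres.w]

/-- By tensor-hom adjunction the maps into `colim (H_i ⊗ M)` form a cocone on the `H_i`, which
yields a map from `X ⊗ M` to this colimit. An element dying in `X ⊗ M` therefore dies in the
filtered colimit, and so at some stage. -/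
lemma exists_balancedTensor_eq_zero {i : ι} (s : BalancedTensor R (pres.diag.obj i) M)
    (hs : balancedMapLeft M (pres.ι.app i).hom s = 0) :
    ∃ (j : ι) (f : i ⟶ j), balancedMapLeft M (pres.diag.map f).hom s = 0 := by
  let D := pres.diag ⋙ tensorRight M
  let A := colimit D
  let c (i : ι) : pres.diag.obj i →ₗ[Rᵐᵒᵖ] RightHom M A :=
    { toFun := fun h => AddMonoidHom.comp (colimit.ι D i).hom
        (btmulHom R (pres.diag.obj i) M h)
      map_add' := fun h h' => by
        refine AddMonoidHom.ext (M := M) (N := A) fun m => ?_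
        refine (congrArg (colimit.ι D i).hom (add_btmul h h' m)).trans ?_
        exact map_add _ _ _
      map_smul' := fun r h => by
        refine AddMonoidHom.ext (M := M) (N := A) fun m => ?_
        exact congrArg (colimit.ι D i).hom (smul_btmul h r m) }
  let γ : Cocone pres.diag :=
    { pt := ModuleCat.of Rᵐᵒᵖ (RightHom M A)
      ι := { app := fun i => ModuleCat.ofHom (c i)
             naturality := fun i j f => by
              refine ModuleCat.hom_ext (LinearMap.ext fun h => ?_)
              refine AddMonoidHom.ext (M := M) (N := A) fun m => ?_
              exact DFunLike.congr_fun (congrArg AddCommGrpCat.Hom.hom (colimit.w D f))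
                (btmul R h m) } }
  let δ : X →ₗ[Rᵐᵒᵖ] RightHom M A := (pres.isColimit.desc γ).hom
  have hδ (h : pres.diag.obj i) : δ ((pres.ι.app i).hom h) = c i h :=
    LinearMap.congr_fun (congrArg ModuleCat.Hom.hom (pres.isColimit.fac γ i)) h
  let Δ : BalancedTensor R X M →+ A :=
    (btlift (AddMonoidHom.mk' (M := X) (G := M →+ A) δ (map_add δ)) fun h r m =>
      DFunLike.congr_fun (F := M →+ A) (map_smul δ (op r) h) m).toAddMonoidHom
  have hΔ : Δ (balancedMapLeft M (pres.ι.app i).hom s) = (colimit.ι D i).hom s := by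
    clear hs
    induction s using balancedTensor_induction with
    | zero => exact (congrArg Δ (map_zero _)).trans ((map_zero Δ).trans (map_zero _).symm)
    | tmul h m => exact DFunLike.congr_fun (F := M →+ A) (hδ h) m
    | add x y hx hy =>
      refine (congrArg Δ (map_add _ x y)).trans ((map_add Δ _ _).trans ?_)
      rw [hx, hy]
      exact (map_add (colimit.ι D i).hom x y).symm
  rw [hs, map_zero] at hΔ
  obtain ⟨k, f, g, h⟩ := Concrete.colimit_exists_of_rep_eq D
    (i := i) (j := i) s (0 : BalancedTensor R (pres.diag.obj i) M)
    (hΔ.symm.trans (map_zero (colimit.ι D i).hom).symm)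
  exact ⟨k, f, h.trans (map_zero (D.map g).hom)⟩

/-- With a projective presentation of `M` fixed, an element of the kernel over `X` is represented at
some stage. At a later stage its image in the tensor product with `P` vanishes, and injectivity
there kills it. -/
lemma dirLim_le_torLeftOrthogonal {C : ObjectProperty (ModuleCat.{u} Rᵐᵒᵖ)}
    {D : ObjectProperty (ModuleCat.{u} R)} (h : C ≤ torLeftOrthogonal D) :
    dirLim C ≤ torLeftOrthogonal D := by
  rintro X ⟨ι, _, _, _, pres, hpres⟩ M hM
  obtain ⟨P, p, _, _, hT⟩ := exists_projective_presentation_tor M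
  rw [hT, injective_iff_map_eq_zero]
  intro t ht
  obtain ⟨i, s, rfl⟩ := exists_balancedTensor_rep pres _ t
  rw [balancedMap_comm] at ht
  obtain ⟨j, f, hj⟩ := exists_balancedTensor_eq_zero pres P _ ht
  rw [← balancedMap_comm] at hj
  have := (injective_iff_map_eq_zero _).1 ((hT _).1 (h _ (hpres j) M hM)) _ hj
  rw [← pres.w f, ModuleCat.hom_comp, balancedMapLeft_comp_apply, this, map_zero]

end TorDirectLimit

/-! ### Coherence and the equivalence of the five assertions -/

section Coherent

variable {R : Type u} [Ring R]

/-- The first syzygy in a finite presentation is finitely generated and flat inside a free module.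
Coherence makes it finitely presented, and a finitely presented flat module is projective. -/
lemma F1fp_le_P1 (hR : IsRightF1fpCoherent R) : F1fp R ≤ P1 R := by
  rintro H ⟨hH, hfp⟩
  obtain ⟨m, n, d, π, hπ, hd⟩ := exists_relations (S := Rᵐᵒᵖ) H
  have hex := LinearMap.exact_subtype_ker_map π
  have hfg : (LinearMap.ker π).FG := Module.FinitePresentation.fg_ker π hπ
  have hflat : IsFlatRight R (ModuleCat.of Rᵐᵒᵖ (LinearMap.ker π)) :=
    isFlatRight_ker_of_hat (F := ModuleCat.of Rᵐᵒᵖ (Fin m → Rᵐᵒᵖ))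
      (isFlatRight_of_projective _) Subtype.val_injective hex hπ (le_hat _ _ hH)
  have hK := hR (Fin m → Rᵐᵒᵖ) (LinearMap.ker π) hfg hflat
  have := projective_of_flat (ModuleCat.of Rᵐᵒᵖ (LinearMap.ker π)) hflat
  exact (P1_iff_of_presentation (K := ModuleCat.of Rᵐᵒᵖ (LinearMap.ker π)) (F := Fin m → Rᵐᵒᵖ)
    (i := (LinearMap.ker π).subtype) Subtype.val_injective hex hπ).2 this

lemma torRightOrthogonal_anti {C D : ObjectProperty (ModuleCat.{u} Rᵐᵒᵖ)} (h : C ≤ D) :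
    torRightOrthogonal D ≤ torRightOrthogonal C :=
  fun _ hM H hH => hM H (h H hH)

lemma F1fpFlat_eq (hR : IsRightF1fpCoherent R) : F1fpFlat R = MatrixFlat R := by
  refine le_antisymm (fun N hN => matrixFlat_of_tor fun a => hN _ (F1fp_matrixCokernel a)) ?_
  rw [← P1Flat_eq]
  exact torRightOrthogonal_anti (F1fp_le_P1 hR)

lemma torLeftOrthogonal_matrixFlat_le_dirLim {C : ObjectProperty (ModuleCat.{u} Rᵐᵒᵖ)}
    (hC : ∀ a : MatrixIndex R, C (matrixCokernel a)) :
    torLeftOrthogonal (MatrixFlat R) ≤ dirLim C := by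
  intro X hX
  have h : FactorsThrough (matrixCokernel (R := R)) X := fun Z hZ f =>
    exists_factorization_matrixCokernel hX hZ f
  obtain ⟨ι, h1, h2, h3, pres, hp⟩ :=
    h.exists_colimitPresentation fun a => (F1fp_matrixCokernel a).2
  refine ⟨ι, h1, h2, h3, pres, fun k => ?_⟩
  obtain ⟨a, ha⟩ := hp k
  exact ha ▸ hC a

lemma dirLim_P1 : dirLim (P1 R) = torLeftOrthogonal (MatrixFlat R) :=
  le_antisymm (dirLim_le_torLeftOrthogonal (P1Flat_eq (R := R) ▸ le_hat _))
    (torLeftOrthogonal_matrixFlat_le_dirLim P1_matrixCokernel)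

lemma dirLim_F1fp (hR : IsRightF1fpCoherent R) :
    dirLim (F1fp R) = torLeftOrthogonal (MatrixFlat R) :=
  le_antisymm (dirLim_le_torLeftOrthogonal (F1fpFlat_eq hR ▸ le_hat _))
    (torLeftOrthogonal_matrixFlat_le_dirLim F1fp_matrixCokernel)

lemma torRightOrthogonal_torLeftOrthogonal_P1Flat :
    torRightOrthogonal (torLeftOrthogonal (P1Flat R)) = P1Flat R :=
  le_antisymm (torRightOrthogonal_anti (le_hat _)) fun _ hN _ hH => hH _ hN

/-- Both classes of left modules are Tor-closed: `MatrixFlat R` is the right orthogonal of its left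
orthogonal, and `F1 R` is the left orthogonal of `F1Flat R`. Passing to orthogonals therefore loses
nothing. -/
lemma torLeftOrthogonal_matrixFlat_eq_F1_iff :
    torLeftOrthogonal (MatrixFlat R) = F1 R ↔ MatrixFlat R = F1Flat R := by
  constructor
  · intro h
    rw [← P1Flat_eq] at h ⊢
    rw [← torRightOrthogonal_torLeftOrthogonal_P1Flat, h]
    rfl
  · intro h
    rw [h]
    exact hat_F1

theorem tfae_of_isRightF1fpCoherent (hR : IsRightF1fpCoherent R) :
    List.TFAE [F1fpFlat R = F1Flat R, P1Flat R = F1Flat R, hat (P1 R) = F1 R,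
      dirLim (F1fp R) = F1 R, dirLim (P1 R) = F1 R] := by
  have hhat : hat (P1 R) = torLeftOrthogonal (MatrixFlat R) :=
    congrArg torLeftOrthogonal P1Flat_eq
  rw [F1fpFlat_eq hR, P1Flat_eq, hhat, dirLim_F1fp hR, dirLim_P1,
    torLeftOrthogonal_matrixFlat_eq_F1_iff]
  tfae_finish

/-- The right modules `R` and `Rᵐᵒᵖ` are isomorphic. -/
def unopLinearEquiv (R : Type u) [Ring R] : Rᵐᵒᵖ ≃ₗ[Rᵐᵒᵖ] R where
  toFun := unop
  invFun := op
  map_add' _ _ := rfl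
  map_smul' _ _ := rfl
  left_inv _ := rfl
  right_inv _ := rfl

lemma finitePresentation_of_injective (hR : IsRightCoherent R) (r : ℕ) :
    ∀ (M : Type u) [AddCommGroup M] [Module Rᵐᵒᵖ M] [Module.Finite Rᵐᵒᵖ M]
      (f : M →ₗ[Rᵐᵒᵖ] (Fin r → Rᵐᵒᵖ)), Function.Injective f →
      Module.FinitePresentation Rᵐᵒᵖ M := by
  induction r with
  | zero =>
    intro M _ _ _ f hf
    have : Subsingleton M := hf.subsingleton
    infer_instance
  | succ r ih =>
    intro M _ _ _ f hf
    -- The first coordinate maps `M` onto a finitely generated right ideal, and its kernel embeds in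
    -- a free module of rank one less.
    let q : M →ₗ[Rᵐᵒᵖ] R := (unopLinearEquiv R).toLinearMap ∘ₗ LinearMap.proj 0 ∘ₗ f
    have hq : Module.FinitePresentation Rᵐᵒᵖ (LinearMap.range q) := hR _ (by
      rw [← Submodule.map_top]
      exact Module.Finite.fg_top.map q)
    have hker : (LinearMap.ker q.rangeRestrict).FG :=
      Module.FinitePresentation.fg_ker _ q.surjective_rangeRestrict
    have : Module.Finite Rᵐᵒᵖ (LinearMap.ker q.rangeRestrict) := Module.Finite.iff_fg.2 hker
    have : Module.FinitePresentation Rᵐᵒᵖ (LinearMap.ker q.rangeRestrict) := by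
      refine ih _ (LinearMap.funLeft Rᵐᵒᵖ Rᵐᵒᵖ Fin.succ ∘ₗ f ∘ₗ Submodule.subtype _) ?_
      rw [injective_iff_map_eq_zero]
      intro x hx
      have h0 : f x 0 = 0 :=
        unop_injective (congrArg Subtype.val (LinearMap.mem_ker.1 x.2))
      refine Subtype.ext (hf (funext fun a => ?_))
      rw [ZeroMemClass.coe_zero, map_zero]
      refine Fin.cases h0 (fun a => congrFun hx a) a
    exact Module.finitePresentation_of_ker _ q.surjective_rangeRestrict

lemma IsRightCoherent.isRightF1fpCoherent (hR : IsRightCoherent R) : IsRightF1fpCoherent R := by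
  intro L _ _ _ N hN _
  obtain ⟨n, y, rfl⟩ := Submodule.fg_iff_exists_fin_generating_family.1 hN
  obtain ⟨r, j, x, hj, hx⟩ := exists_finite_free (S := Rᵐᵒᵖ) y
  let e := (Submodule.equivMapOfInjective j hj (Submodule.span Rᵐᵒᵖ (Set.range x)))
  have hmap : (Submodule.span Rᵐᵒᵖ (Set.range x)).map j =
      Submodule.span Rᵐᵒᵖ (Set.range y) := by
    rw [Submodule.map_span, ← Set.range_comp, show j ∘ x = y from funext hx]
  have : Module.Finite Rᵐᵒᵖ (Submodule.span Rᵐᵒᵖ (Set.range x)) :=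
    Module.Finite.span_of_finite _ (Set.finite_range x)
  have h := finitePresentation_of_injective hR r (Submodule.span Rᵐᵒᵖ (Set.range x))
    ((Finsupp.linearEquivFunOnFinite Rᵐᵒᵖ Rᵐᵒᵖ (Fin r)).toLinearMap ∘ₗ Submodule.subtype _)
    ((Finsupp.linearEquivFunOnFinite Rᵐᵒᵖ Rᵐᵒᵖ (Fin r)).injective.comp Subtype.val_injective)
  rw [← hmap]
  exact Module.FinitePresentation.of_equiv (M := Submodule.span Rᵐᵒᵖ (Set.range x)) e

end Coherent

/-! ### Commutative rings -/

section Commutative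

variable {R : Type u} [CommRing R]

/-- The canonical ring homomorphism `Rᵐᵒᵖ → R` of a commutative ring. -/
def unopRingHom (R : Type u) [CommRing R] : Rᵐᵒᵖ →+* R :=
  (RingHom.id R).fromOpposite fun _ _ => Commute.all _ _

/-- A module over a commutative ring as a right module. -/
noncomputable abbrev asRight (A : ModuleCat.{u} R) : ModuleCat.{u} Rᵐᵒᵖ :=
  (ModuleCat.restrictScalars (unopRingHom R)).obj A

lemma isFlatRight_asRight (A : ModuleCat.{u} R) [Module.Flat R A] : IsFlatRight R (asRight A) := by
  rw [isFlatRight_iff]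
  intro M N _ _ _ _ f hf
  let e (M : Type u) [AddCommGroup M] [Module R M] :
      BalancedTensor R (asRight A) M →ₗ[ℤ] A ⊗[R] M :=
    btlift (A := A ⊗[R] M)
      (AddMonoidHom.mk' (M := A) (fun a => (TensorProduct.mk R A M a).toAddMonoidHom)
      fun a b => AddMonoidHom.ext fun m => TensorProduct.add_tmul a b m)
      fun a r m => TensorProduct.smul_tmul (R := R) (M := A) r a m
  let e' (M : Type u) [AddCommGroup M] [Module R M] :
      A ⊗[R] M →+ BalancedTensor R (asRight A) M :=
    TensorProduct.liftAddHom (btmulHom R (asRight A) M)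
      fun r a m => (btmul_smul (H := asRight A) a r m).symm
  have he (t : BalancedTensor R (asRight A) M) : e' M (e M t) = t := by
    induction t using balancedTensor_induction with
    | zero => simp
    | tmul h m => rfl
    | add x y hx hy => rw [map_add, map_add, hx, hy]
  have hef (t : BalancedTensor R (asRight A) M) :
      e N (balancedMap _ f t) = f.lTensor A (e M t) := by
    induction t using balancedTensor_induction with
    | zero => simp
    | tmul h m => rfl
    | add x y hx hy => rw [map_add, map_add, map_add, map_add, hx, hy]
  rw [injective_iff_map_eq_zero]
  intro t ht
  have h1 := hef t
  rw [ht, map_zero] at h1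
  have h2 : e M t = 0 := Module.Flat.lTensor_preserves_injective_linearMap f hf
    (h1.symm.trans (map_zero _).symm)
  rw [← he t, h2, map_zero]

lemma isRightCoherent_of_isNoetherianRing [IsNoetherianRing R] : IsRightCoherent R := by
  have : IsNoetherianRing Rᵐᵒᵖ := isNoetherianRing_of_ringEquiv R (RingEquiv.toOpposite R)
  intro I hI
  have : Module.Finite Rᵐᵒᵖ I := Module.Finite.iff_fg.2 hI
  exact Module.finitePresentation_of_finite Rᵐᵒᵖ I

end Commutative

/-! ### The counterexample -/

section Example

variable (k : Type u) [Field k]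

open MvPolynomial

/-- The classes of the variables. -/
noncomputable def bhVar (i : Fin 3) : BazzoniHerberaRing k :=
  Ideal.Quotient.mk _ (X i)

variable {k}

lemma mul_mem_bazzoniHerberaIdeal (i : Fin 3) (p : MvPolynomial (Fin 3) k) :
    X 2 * X i * p ∈ bazzoniHerberaIdeal k := by
  refine Ideal.mul_mem_right _ _ (Ideal.subset_span ?_)
  fin_cases i
  · simp
  · simp
  · simp [pow_two]

lemma bhVar_two_mul (i : Fin 3) : bhVar k 2 * bhVar k i = 0 := by
  rw [bhVar, bhVar, ← map_mul, Ideal.Quotient.eq_zero_iff_mem]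
  simpa using mul_mem_bazzoniHerberaIdeal (k := k) i 1

/-- A ring homomorphism out of `k[x, y, z]` for which the products of the value at `z` with the
values at the variables vanish factors through `k[x, y, z] / (z², zx, zy)`. -/
noncomputable def bhLift {B : Type*} [CommRing B] [Algebra k B] (b : Fin 3 → B)
    (hb : ∀ i, b 2 * b i = 0) : BazzoniHerberaRing k →+* B :=
  Ideal.Quotient.lift _ (aeval b : MvPolynomial (Fin 3) k →ₐ[k] B).toRingHom <| by
    change ∀ a ∈ bazzoniHerberaIdeal k, a ∈ RingHom.ker (aeval b).toRingHom
    refine Ideal.span_le.2 ?_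
    rintro _ (rfl | rfl | rfl)
    · simpa [pow_two] using hb 2
    · simpa using hb 0
    · simpa using hb 1

@[simp]
lemma bhLift_mk {B : Type*} [CommRing B] [Algebra k B] (b : Fin 3 → B)
    (hb : ∀ i, b 2 * b i = 0) (p : MvPolynomial (Fin 3) k) :
    bhLift b hb (Ideal.Quotient.mk _ p) = aeval b p := rfl

@[simp]
lemma bhLift_bhVar {B : Type*} [CommRing B] [Algebra k B] (b : Fin 3 → B)
    (hb : ∀ i, b 2 * b i = 0) (i : Fin 3) : bhLift b hb (bhVar k i) = b i := by
  rw [bhVar, bhLift_mk, aeval_X]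

lemma bhVar_two_ne_zero : bhVar k 2 ≠ 0 := by
  intro h
  -- The dual numbers are the quotient by `x` and `y`, where `z` becomes the nonzero element `ε`.
  have := congrArg (bhLift (k := k) ![0, 0, (DualNumber.eps : DualNumber k)] (by
    intro i
    fin_cases i <;> simp)) h
  rw [bhLift_bhVar, map_zero] at this
  have := congrArg TrivSqZeroExt.snd this
  simp at this

/-- The evaluation of `k[x, y, z] / (z², zx, zy)` in `k[X]` sending `y` to `X` and `x, z` to `0`. -/
noncomputable def bhEval (k : Type u) [Field k] : BazzoniHerberaRing k →+* Polynomial k :=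
  bhLift ![0, Polynomial.X, 0] (by simp)

/-- All variables are killed by `z`, so only the constant term of `r` survives; `bhEval` is used
here just to read it off. -/
lemma bhVar_two_mul_eq (r : BazzoniHerberaRing k) :
    bhVar k 2 * r = bhVar k 2 * Ideal.Quotient.mk _ (C ((bhEval k r).coeff 0)) := by
  obtain ⟨p, rfl⟩ := Ideal.Quotient.mk_surjective r
  induction p using MvPolynomial.induction_on with
  | C a => simp [bhEval, ← MvPolynomial.algebraMap_eq]
  | add p q hp hq => simp only [map_add, mul_add, hp, hq, Polynomial.coeff_add]
  | mul_X p i hp =>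
    have h1 : bhVar k 2 * Ideal.Quotient.mk (bazzoniHerberaIdeal k) (X i) = 0 := bhVar_two_mul i
    have h2 : (bhEval k (Ideal.Quotient.mk _ (X i))).coeff 0 = 0 := by
      change (bhEval k (bhVar k i)).coeff 0 = 0
      rw [bhEval, bhLift_bhVar]
      fin_cases i <;> simp
    rw [map_mul, map_mul, mul_left_comm, h1, Polynomial.mul_coeff_zero, h2]
    simp

/-- `k[X]` as a module over `k[x, y, z] / (z², zx, zy)`. -/
noncomputable abbrev bhPolyModule (k : Type u) [Field k] : ModuleCat.{u} (BazzoniHerberaRing k) :=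
  (ModuleCat.restrictScalars (bhEval k)).obj (ModuleCat.of (Polynomial k) (Polynomial k))

/-- If `A n = 0` with `n` nonzero, the lowest-degree coefficients of `n` form a nonzero vector over
`k` killed by the constant terms of `A`. Multiplying this vector by `z` gives a nonzero column over
the ring killed by `A`. -/
lemma matrixFlat_bhPolyModule : MatrixFlat (BazzoniHerberaRing k) (bhPolyModule k) := by
  classical
  intro s t A hA n hn
  change Fin s → Polynomial k at n
  replace hn : ∀ i, ∑ j, bhEval k (A i j) * n j = 0 := hn
  by_contra hne
  have hex : ∃ d, ∃ j, (n j).coeff d ≠ 0 := by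
    by_contra! h
    exact hne (funext fun j => Polynomial.ext fun d => h d j)
  let d := Nat.find hex
  have hd : ∀ e < d, ∀ j, (n j).coeff e = 0 := fun e he j => by
    by_contra h
    exact Nat.find_min hex he ⟨j, h⟩
  obtain ⟨j₀, hj₀⟩ : ∃ j, (n j).coeff d ≠ 0 := Nat.find_spec hex
  have hcoeff (i) : ∑ j, (bhEval k (A i j)).coeff 0 * (n j).coeff d = 0 := by
    have := congrArg (fun p => Polynomial.coeff p d) (hn i)
    simp only [Polynomial.finsetSum_coeff, Polynomial.coeff_mul, Polynomial.coeff_zero] at this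
    rw [← this]
    refine Finset.sum_congr rfl fun j _ => ?_
    rw [Finset.sum_eq_single (0, d)]
    · rintro ⟨a, b⟩ hab hne
      rw [Finset.HasAntidiagonal.mem_antidiagonal] at hab
      have : b < d := by
        rcases Nat.eq_zero_or_pos a with rfl | ha
        · exact absurd (by simpa using hab) hne
        · simp only at hab
          omega
      rw [hd b this j, mul_zero]
    · simp
  have := hA (fun j => bhVar k 2 * Ideal.Quotient.mk _ (C ((n j).coeff d))) fun i => by
    have : ∀ j, A i j * (bhVar k 2 * Ideal.Quotient.mk _ (C ((n j).coeff d))) =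
        bhVar k 2 * Ideal.Quotient.mk _ (C ((bhEval k (A i j)).coeff 0 * (n j).coeff d)) := by
      intro j
      rw [← mul_assoc, mul_comm (A i j), bhVar_two_mul_eq, mul_assoc, map_mul, map_mul]
    simp only [this]
    rw [← Finset.mul_sum, ← map_sum, ← map_sum, hcoeff]
    simp
  have h0 := congrFun this j₀
  refine bhVar_two_ne_zero (k := k) ?_
  have h1 := congrArg (fun r => r * Ideal.Quotient.mk _ (C ((n j₀).coeff d)⁻¹)) h0
  simp only [Pi.zero_apply, zero_mul] at h1
  rwa [mul_assoc, ← map_mul, ← map_mul, mul_inv_cancel₀ hj₀, map_one, map_one, mul_one] at h1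

/-- Since `yz = 0` in the quotient, multiplying by `y` makes setting `z = 0` harmless. -/
lemma X_one_mul_sub_mem (p : MvPolynomial (Fin 3) k) :
    X 1 * (p - aeval ![X 0, X 1, 0] p) ∈ bazzoniHerberaIdeal k := by
  induction p using MvPolynomial.induction_on with
  | C a => simp
  | add p q hp hq =>
    have : X 1 * (p + q - aeval ![X 0, X 1, 0] (p + q)) = X 1 * (p - aeval ![X 0, X 1, 0] p) +
        X 1 * (q - aeval ![X 0, X 1, 0] q) := by
      rw [map_add]
      ring
    rw [this]
    exact add_mem hp hq
  | mul_X p i hp =>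
    have : X 1 * (p * X i - aeval ![X 0, X 1, 0] (p * X i)) =
        X 1 * (p - aeval ![X 0, X 1, 0] p) * X i +
          aeval ![X 0, X 1, 0] p * (X 1 * (X i - ![X 0, X 1, 0] i)) := by
      rw [map_mul, aeval_X]
      ring
    rw [this]
    refine add_mem (Ideal.mul_mem_right _ _ hp) (Ideal.mul_mem_left _ _ ?_)
    fin_cases i
    · simp
    · simp
    · simpa [mul_comm] using mul_mem_bazzoniHerberaIdeal (k := k) 1 1

/-- After setting `z = 0` the equation lives in a domain, so a representative of `r` vanishes there;
multiplying by `y` then kills `r`. Hence `x` is a nonzerodivisor on the localization at `y`. -/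
lemma bhVar_one_mul_eq_zero {r : BazzoniHerberaRing k} {m : ℕ}
    (h : bhVar k 1 ^ m * (bhVar k 0 * r) = 0) : bhVar k 1 * r = 0 := by
  obtain ⟨p, rfl⟩ := Ideal.Quotient.mk_surjective r
  have h1 := congrArg (bhLift (k := k) (B := MvPolynomial (Fin 3) k) ![X 0, X 1, 0] (by simp)) h
  rw [map_mul, map_mul, map_pow, bhLift_bhVar, bhLift_bhVar, bhLift_mk, map_zero] at h1
  have h2 : aeval ![X 0, X 1, 0] p = (0 : MvPolynomial (Fin 3) k) := by
    simpa [X_ne_zero] using h1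
  have := X_one_mul_sub_mem p
  rw [h2, sub_zero] at this
  rw [bhVar, ← map_mul]
  exact Ideal.Quotient.eq_zero_iff_mem.2 this

/-- The localization of `k[x, y, z] / (z², zx, zy)` at the powers of `y`. -/
abbrev BhLocalization (k : Type u) [Field k] : Type u := Localization.Away (bhVar k 1)

lemma bhVar_zero_smul_injective :
    Function.Injective (LinearMap.lsmul (BazzoniHerberaRing k) (BhLocalization k) (bhVar k 0)) := by
  rw [injective_iff_map_eq_zero]
  intro a ha
  obtain ⟨r, s, rfl⟩ := IsLocalization.exists_mk'_eq (Submonoid.powers (bhVar k 1)) a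
  have ha' := (Algebra.smul_def (bhVar k 0)
    (IsLocalization.mk' (BhLocalization k) r s)).symm.trans ha
  rw [IsLocalization.mul_mk'_eq_mk'_of_mul, IsLocalization.mk'_eq_zero_iff] at ha'
  obtain ⟨⟨_, m, rfl⟩, hm⟩ := ha'
  rw [IsLocalization.mk'_eq_zero_iff]
  exact ⟨⟨_, 1, rfl⟩, by simpa using bhVar_one_mul_eq_zero hm⟩

/-- The localization at the powers of `y` as a right module. -/
noncomputable abbrev bhRightLocalization (k : Type u) [Field k] :
    ModuleCat.{u} (BazzoniHerberaRing k)ᵐᵒᵖ :=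
  asRight (ModuleCat.of (BazzoniHerberaRing k) (BhLocalization k))

/-- Multiplication by `x` on the right module `R_y`. -/
noncomputable def bhMul (k : Type u) [Field k] :
    bhRightLocalization k →ₗ[(BazzoniHerberaRing k)ᵐᵒᵖ]
      bhRightLocalization k :=
  ((ModuleCat.restrictScalars (unopRingHom (BazzoniHerberaRing k))).map
    (ModuleCat.ofHom (LinearMap.lsmul (BazzoniHerberaRing k) (BhLocalization k) (bhVar k 0)))).hom

lemma bhMul_injective : Function.Injective (bhMul k) := bhVar_zero_smul_injective

/-- The tensor `1 ⊗ 1` is killed because `x` acts as zero on `k[X]`. It is nonzero because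
multiplication in the field `k(X)`, where `y` becomes invertible, sends it to `1`. -/
lemma not_injective_bhMul : ¬ Function.Injective (balancedMapLeft (bhPolyModule k) (bhMul k)) := by
  intro h
  let one : bhRightLocalization k := (1 : BhLocalization k)
  let one' : bhPolyModule k := (1 : Polynomial k)
  have h0 : bhVar k 0 • one' = 0 := by
    change bhEval k (bhVar k 0) * (1 : Polynomial k) = 0
    rw [bhEval, bhLift_bhVar]
    simp
  have h1 : balancedMapLeft (bhPolyModule k) (bhMul k) (btmul (BazzoniHerberaRing k) one one') = 0 := by
    have : bhMul k one = op (bhVar k 0) • one := rfl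
    rw [balancedMapLeft_btmul, this, ← btmul_smul, h0, btmul_zero]
  have h2 : btmul (BazzoniHerberaRing k) one one' = 0 := (injective_iff_map_eq_zero _).1 h _ h1
  let L := FractionRing (Polynomial k)
  let g : BazzoniHerberaRing k →+* L := (algebraMap (Polynomial k) L).comp (bhEval k)
  have hg : IsUnit (g (bhVar k 1)) := by
    refine IsUnit.mk0 _ ?_
    simp [g, bhEval, Polynomial.X_ne_zero]
  let l : BhLocalization k →+* L := IsLocalization.Away.lift (bhVar k 1) hg
  let φ : BhLocalization k →+ Polynomial k →+ L :=
    (AddMonoidHom.mul.comp l.toAddMonoidHom).compl₂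
      (algebraMap (Polynomial k) L).toAddMonoidHom
  have hl (a : BhLocalization k) (r : BazzoniHerberaRing k) (n : Polynomial k) :
      l (r • a) * algebraMap (Polynomial k) L n =
        l a * algebraMap (Polynomial k) L (bhEval k r * n) := by
    have h3 : l (r • a) = g r * l a := (congrArg l (Algebra.smul_def r a)).trans <| by
      rw [map_mul, IsLocalization.Away.lift_eq]
    rw [h3, map_mul]
    simp only [g, RingHom.comp_apply]
    ring
  let Φ := btlift (R := BazzoniHerberaRing k) (H := bhRightLocalization k)
    (M := bhPolyModule k) (A := L) φ fun a r n => hl a r n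
  have h3 := congrArg Φ h2
  rw [map_zero] at h3
  have h4 : Φ (btmul (BazzoniHerberaRing k) one one') = 1 := by
    change l 1 * algebraMap (Polynomial k) L 1 = 1
    rw [map_one, map_one, mul_one]
  exact one_ne_zero (h4.symm.trans h3)

theorem dirLim_F1fp_bazzoniHerberaRing_ne : dirLim (F1fp (BazzoniHerberaRing k)) ≠ F1 (BazzoniHerberaRing k) := by
  intro h
  rw [dirLim_F1fp isRightCoherent_of_isNoetherianRing.isRightF1fpCoherent] at h
  have hex := LinearMap.exact_map_mkQ_range (bhMul k)
  have hflat : IsFlatRight _ (bhRightLocalization k) :=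
    have : Module.Flat (BazzoniHerberaRing k) (ModuleCat.of (BazzoniHerberaRing k) (BhLocalization k)) :=
      IsLocalization.flat (BhLocalization k) (Submonoid.powers (bhVar k 1))
    isFlatRight_asRight _
  -- This is `R_y / x R_y`, whose flat resolution is multiplication by `x` on `R_y`.
  let H := ModuleCat.of (BazzoniHerberaRing k)ᵐᵒᵖ (_ ⧸ LinearMap.range (bhMul k))
  have hH : F1 (BazzoniHerberaRing k) H := (F1_iff H).2 ⟨_, _, bhMul k, (LinearMap.range (bhMul k)).mkQ,
    bhMul_injective, hex, Submodule.mkQ_surjective _, hflat, hflat⟩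
  rw [← h] at hH
  exact not_injective_bhMul ((isZero_tor_one_iff hflat bhMul_injective hex
    (Submodule.mkQ_surjective _) _).1 (hH _ matrixFlat_bhPolyModule))

end Example

end RelFlat

theorem proposition3p3 :
    (∀ (R : Type u) [Ring R], RelFlat.IsRightF1fpCoherent R →
      List.TFAE [
        RelFlat.F1fpFlat R = RelFlat.F1Flat R,
        RelFlat.P1Flat R = RelFlat.F1Flat R,
        RelFlat.hat (RelFlat.P1 R) = RelFlat.F1 R,
        RelFlat.dirLim (RelFlat.F1fp R) = RelFlat.F1 R,
        RelFlat.dirLim (RelFlat.P1 R) = RelFlat.F1 R]) ∧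
    (∀ (R : Type u) [Ring R], RelFlat.IsRightCoherent R →
      List.TFAE [
        RelFlat.F1fpFlat R = RelFlat.F1Flat R,
        RelFlat.P1Flat R = RelFlat.F1Flat R,
        RelFlat.hat (RelFlat.P1 R) = RelFlat.F1 R,
        RelFlat.dirLim (RelFlat.F1fp R) = RelFlat.F1 R,
        RelFlat.dirLim (RelFlat.P1 R) = RelFlat.F1 R]) ∧
    (∀ (k : Type u) [Field k],
      RelFlat.IsRightCoherent (RelFlat.BazzoniHerberaRing k) ∧
      RelFlat.dirLim (RelFlat.F1fp (RelFlat.BazzoniHerberaRing k)) ≠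
        RelFlat.F1 (RelFlat.BazzoniHerberaRing k)) := by
  exact ⟨fun _ _ hR => RelFlat.tfae_of_isRightF1fpCoherent hR,
    fun _ _ hR => RelFlat.tfae_of_isRightF1fpCoherent hR.isRightF1fpCoherent,
    fun _ _ => ⟨RelFlat.isRightCoherent_of_isNoetherianRing,
      RelFlat.dirLim_F1fp_bazzoniHerberaRing_ne⟩⟩
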